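/- Let $I\subseteq\mathbb{R}$ be an open set of times, let $\phi:I\times\mathbb{R}^3\to\mathbb{R}$ and $u:I\times\mathbb{R}^3\to\mathbb{R}^3$ be $C^\infty$ with $\phi_t+u\cdot\nabla\phi=0$ on $I\times\mathbb{R}^3$, and assume that $\nabla\phi(t,x)\neq0$ whenever $\phi(t,x)=0$. Let $Q\subset\mathbb{R}^3$ be a bounded open set that contains the surfaces $\{\phi(t,\cdot)=0\}$, $t\in I$ (which are therefore compact). Let $f$ be a real function on $\mathbb{R}^3$ that is $C^\infty$ on $\mathbb{R}^3\setminus\{0\}$. Write $d\sigma$ for surface area (two-dimensional Hausdorff measure, normalized to agree with Lebesgue measure on planes), $n=\nabla\phi/|\nabla\phi|$ (where $\nabla\phi\ne0$), $\nabla f(n)$ for the gradient of $f$ evaluated at $n$, $\nabla_{\partial\Omega}f(n)=(I-n\otimes n)\nabla f(n)$, $\operatorname{div}_{\partial\Omega}v=\operatorname{div}v-([\nabla v]\,n)\cdot n$, and $H=\operatorname{div}_{\partial\Omega}n$ for the mean curvature (sum of the principal curvatures). Put $J(t)=\int_{\{\phi(t,\cdot)=0\}}f(n)\,d\sigma$.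 For a continuous function $\zeta\ge0$ on $\mathbb{R}$ with support in $[-1,1]$ and $\int_{\mathbb{R}}\zeta=1$, put $J_\varepsilon(t)=\int_Q f(n)\,|\nabla\phi|\,\frac1\varepsilon\zeta\!\left(\frac{\phi}{\varepsilon}\right)dx$. All integrals over $Q$ are understood for small $\varepsilon>0$, with integrand $0$ where $\nabla\phi=0$. All integrands below are integrable, and: 1. For every $t\in I$, $J$ is differentiable at $t$ and $$J'(t)=\int_{\{\phi=0\}}\bigl(f(n)H+\operatorname{div}_{\partial\Omega}(\nabla_{\partial\Omega}f(n))\bigr)\,u\cdot n\,d\sigma .$$ 2. If moreover $f(sx)=s f(x)$ for all $s>0$ and $x\ne0$, then for every $t\in I$ $$J'(t)=\int_{\{\phi=0\}}\operatorname{div}_{\partial\Omega}(\nabla f(n))\,u\cdot n\,d\sigma .$$ 3. At every point with $t\in I$ and $\nabla\phi\neq0$, $$\operatorname{div}\bigl(f(n)n+\nabla_{\partial\Omega}f(n)\bigr)=f(n)H+\operatorname{div}_{\partial\Omega}(\nabla_{\partial\Omega}f(n)).$$ 4. Let $\zeta$ be as above. For every compact interval $[a,b]\subseteq I$ there is $\varepsilon_0>0$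 such that for all $0<\varepsilon<\varepsilon_0$ and all $t\in[a,b]$, $J_\varepsilon$ is differentiable at $t$ and $$J_\varepsilon'(t)=\int_Q\operatorname{div}\bigl(f(n)n+\nabla_{\partial\Omega}f(n)\bigr)\,u\cdot n\,|\nabla\phi|\,\frac1\varepsilon\zeta\!\left(\frac{\phi}{\varepsilon}\right)dx .$$ For every $t\in I$, as $\varepsilon\to0^+$, $J_\varepsilon(t)\to J(t)$, and the right-hand side of the last formula converges to the right-hand side of the formula in 1. -/

import Mathlib

open MeasureTheory Set Filter Topology
open scoped Gradient ContDiff RealInnerProductSpace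

noncomputable section

namespace LevelSet

/-- Euclidean space `ℝ³`. -/
abbrev E3 : Type := EuclideanSpace ℝ (Fin 3)

/-- The divergence `∑ i, ∂ᵢ vᵢ` of a vector field. -/
def divergence (v : E3 → E3) (x : E3) : ℝ :=
  ∑ i : Fin 3, fderiv ℝ v x (EuclideanSpace.single i 1) i

/-- The unit normal `n = ∇φ / |∇φ|` of the level sets of `φ`, a unit extension of the normal of
`{φ = 0}` to the open set `{∇φ ≠ 0}`. -/
def unitNormal (φ : E3 → ℝ) (x : E3) : E3 := ‖∇ φ x‖⁻¹ • ∇ φ x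

/-- The tangential part `(I - ν ⊗ ν) w = w - (w · ν) ν` of a vector `w`. -/
def tangentialPart (ν w : E3) : E3 := w - ⟪w, ν⟫ • ν

/-- The tangential divergence `div v - ([∇v] ν) · ν` with respect to a unit normal field `ν`. -/
def tangentialDiv (ν v : E3 → E3) (x : E3) : ℝ :=
  divergence v x - ⟪fderiv ℝ v x (ν x), ν x⟫

/-- The mean curvature `H`, i.e. the tangential divergence of the normal (the sum of the
principal curvatures). -/
def meanCurvature (φ : E3 → ℝ) (x : E3) : ℝ :=
  tangentialDiv (unitNormal φ) (unitNormal φ) x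

/-- The vector field `∇f(n)`: the gradient of `f`, evaluated at the unit normal. -/
def gradAtNormal (f φ : E3 → ℝ) (x : E3) : E3 := ∇ f (unitNormal φ x)

/-- The vector field `(I - n ⊗ n) ∇f(n)`, the tangential part of `∇f(n)`. -/
def tangentialGradAtNormal (f φ : E3 → ℝ) (x : E3) : E3 :=
  tangentialPart (unitNormal φ x) (gradAtNormal f φ x)

/-- The integral of `f(n)` over `{φ = 0}` with respect to surface area. -/
def surfaceFunctional (f φ : E3 → ℝ) : ℝ :=
  ∫ x in {x | φ x = 0}, f (unitNormal φ x) ∂μHE[2]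

/-- The density `f(n) H + div_τ ((I - n ⊗ n) ∇f(n))`. -/
def surfaceDensity (f φ : E3 → ℝ) (x : E3) : ℝ :=
  f (unitNormal φ x) * meanCurvature φ x
    + tangentialDiv (unitNormal φ) (tangentialGradAtNormal f φ) x

/-- The anisotropic mean curvature `div_τ (∇f(n))`. -/
def anisotropicMeanCurvature (f φ : E3 → ℝ) (x : E3) : ℝ :=
  tangentialDiv (unitNormal φ) (gradAtNormal f φ) x

/-- The density `div (f(n) n + (I - n ⊗ n) ∇f(n))`, with the full divergence of `ℝ³`. -/
def volumicDensity (f φ : E3 → ℝ) (x : E3) : ℝ :=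
  divergence (fun y => f (unitNormal φ y) • unitNormal φ y + tangentialGradAtNormal f φ y) x

/-- The weight `|∇φ| (1/ε) ζ(φ/ε)` that approximates the area measure of `{φ = 0}`. -/
def volumicWeight (ζ : ℝ → ℝ) (ε : ℝ) (φ : E3 → ℝ) (x : E3) : ℝ :=
  ‖∇ φ x‖ * (1 / ε * ζ (φ x / ε))

/-- The volumic approximation `∫_Q f(n) |∇φ| (1/ε) ζ(φ/ε) dx` of the surface functional. -/
def volumicFunctional (Q : Set E3) (ζ : ℝ → ℝ) (ε : ℝ) (f φ : E3 → ℝ) : ℝ :=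
  ∫ x in Q, f (unitNormal φ x) * volumicWeight ζ ε φ x

/-- The normal velocity `u · n`. -/
def normalVelocity (u : E3 → E3) (φ : E3 → ℝ) (x : E3) : ℝ := ⟪u x, unitNormal φ x⟫

/-- A continuous nonnegative cut-off function with support in `[-1, 1]` and integral one. -/
structure IsCutoff (ζ : ℝ → ℝ) : Prop where
  continuous : Continuous ζ
  nonneg : ∀ r, 0 ≤ ζ r
  support_subset : Function.support ζ ⊆ Icc (-1) 1
  integral_eq_one : ∫ r, ζ r = 1

end LevelSet

end

/-!
The surface functional is the limit of its volumic approximation, and the derivative passes to the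
limit because the first-order Taylor expansion of the approximation has an error `C (s - t)²` with
`C` independent of `ε`.

*The derivative of the approximation.* Let `F(p) = |p| f(p/|p|)` be the one-homogeneous extension of
`f`, so that `f(n) |∇φ| = F(∇φ)` and `∇F(∇φ) = f(n) n + ∇_τ f(n)`. For a `C¹` weight `h`,
differentiate `∫ F(∇φ) h(φ)` under the integral and subtract the integral of a divergence; the terms
with `h'` cancel because `∇F(p) · p = F(p)`, and what is left is
`∫ div (∇F(∇φ)) (u · ∇φ) h(φ)` (`hasDerivAt_weighted`, `volumic_first_variation`). The integrand is
multiplied by a smooth space-time cutoff, equal to `1` near the set where `h(φ)` is supported, which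
makes every function involved smooth and compactly supported in the region where `∇φ ≠ 0`
(`Admissible`, `exists_cutoff`).

*Uniformity.* The derivative is an integral of the same kind, so its own derivative is too. Such an
integral `∫ a h(φ)` is bounded independently of the probability density `h`: write
`a h(φ) = a w · ∇(H(φ))` with `w = ∇φ/|∇φ|²`, `H' = h`, and integrate by parts, so that only the
bounded factor `H(φ)` remains (`exists_abs_weighted_le`). The resulting quadratic estimate
(`exists_weighted_taylor`) is stable under limits. It extends to continuous weights by uniform
approximation, giving the derivative of the volumic functional, and to `ε → 0`, giving the
derivative of the surface functional.

*Convergence at a fixed time.* The weight `|∇φ| ε⁻¹ ζ(φ/ε)` tends to the area measure of the zero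
set (`tendsto_volumic`). For a plane this is Fubini's theorem. Near a regular point a homeomorphism
with bi-Lipschitz constant close to `1` makes `φ` linear (`exists_flattening`), and such a map distorts
Lebesgue measure and two-dimensional Hausdorff measure by factors close to `1`. No area formula is
needed.

*Densities.* Differentiating `|n|² = 1` and `∇_τ f(n) · n = 0` turns the full divergence into the
tangential one (`volumicDensity_eq_surfaceDensity`), and Euler's identity gives the homogeneous
case (`anisotropicMeanCurvature_eq_surfaceDensity`).
-/

namespace LevelSet

open scoped Convolution

/-! ### Euclidean Hausdorff measure under bi-Lipschitz maps -/

/-- A homeomorphism whose inverse is `K`-Lipschitz increases `d`-dimensional integrals by a factor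
of at most `K ^ d`. -/
lemma lintegral_comp_homeomorph_le {X Y : Type*} [EMetricSpace X] [MeasurableSpace X]
    [BorelSpace X] [EMetricSpace Y] [MeasurableSpace Y] [BorelSpace Y] (e : X ≃ₜ Y)
    {K : NNReal} (hK : LipschitzWith K e.symm) (d : ℕ) {F : Y → ENNReal} (hF : Measurable F) :
    ∫⁻ x, F (e x) ∂μHE[d] ≤ (K : ENNReal) ^ d * ∫⁻ y, F y ∂μHE[d] := by
  have hle : (μHE[d] : Measure X).map e ≤ ((K : ENNReal) ^ d) • (μHE[d] : Measure Y) := by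
    refine Measure.le_iff.2 fun s hs => ?_
    rw [Measure.map_apply e.measurable hs, ← e.image_symm]
    simp only [Measure.euclideanHausdorffMeasure_def, Measure.smul_apply]
    have h := hK.hausdorffMeasure_image_le (d := d) (by positivity) s
    rw [ENNReal.rpow_natCast] at h
    simp only [ENNReal.smul_def, smul_eq_mul]
    calc _ ≤ _ * ((K : ENNReal) ^ d * μH[d] s) := by gcongr
      _ = _ := by ring
  calc ∫⁻ x, F (e x) ∂μHE[d] = ∫⁻ y, F y ∂((μHE[d] : Measure X).map e) :=
        (lintegral_map hF e.measurable).symm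
    _ ≤ ∫⁻ y, F y ∂(((K : ENNReal) ^ d) • (μHE[d] : Measure Y)) := lintegral_mono' hle le_rfl
    _ = _ := by rw [lintegral_smul_measure, smul_eq_mul]

lemma integral_comp_homeomorph_le {X Y : Type*} [EMetricSpace X] [MeasurableSpace X]
    [BorelSpace X] [EMetricSpace Y] [MeasurableSpace Y] [BorelSpace Y] (e : X ≃ₜ Y)
    {K : NNReal} (hK : LipschitzWith K e.symm) (d : ℕ) {F : Y → ℝ} (hm : Measurable F)
    (h0 : ∀ y, 0 ≤ F y) (hF : Integrable F μHE[d]) :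
    Integrable (fun x => F (e x)) μHE[d] ∧
      ∫ x, F (e x) ∂μHE[d] ≤ (K : ℝ) ^ d * ∫ y, F y ∂μHE[d] := by
  have hle := lintegral_comp_homeomorph_le e hK d hm.ennreal_ofReal
  have hfin : ∫⁻ y, ENNReal.ofReal (F y) ∂μHE[d] ≠ ⊤ :=
    ((hasFiniteIntegral_iff_ofReal (ae_of_all _ h0)).1 hF.2).ne
  have hfin' : (K : ENNReal) ^ d * ∫⁻ y, ENNReal.ofReal (F y) ∂μHE[d] ≠ ⊤ :=
    ENNReal.mul_ne_top (by simp) hfin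
  refine ⟨⟨(hm.comp e.measurable).aestronglyMeasurable,
    (hasFiniteIntegral_iff_ofReal (ae_of_all _ fun x => h0 (e x))).2
      (hle.trans_lt hfin'.lt_top)⟩, ?_⟩
  rw [integral_eq_lintegral_of_nonneg_ae (ae_of_all _ fun x => h0 (e x))
      (hm.comp e.measurable).aestronglyMeasurable,
    integral_eq_lintegral_of_nonneg_ae (ae_of_all _ h0) hm.aestronglyMeasurable]
  refine (ENNReal.toReal_mono hfin' hle).trans ?_
  simp [ENNReal.toReal_mul]

/-! ### The volumic approximation of a plane -/

lemma IsCutoff.hasCompactSupport {ζ : ℝ → ℝ} (hζ : IsCutoff ζ) : HasCompactSupport ζ :=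
  HasCompactSupport.of_support_subset_isCompact isCompact_Icc hζ.support_subset

lemma finrank_orthogonal_span {ν : E3} (hν : ‖ν‖ = 1) :
    Module.finrank ℝ (ℝ ∙ ν)ᗮ = 2 := by
  have h := (ℝ ∙ ν).finrank_add_finrank_orthogonal
  have hν0 : ν ≠ 0 := by rintro rfl; simp at hν
  rw [finrank_span_singleton hν0] at h
  simp at h
  omega

lemma integrableOn_plane {ν : E3} (hν : ‖ν‖ = 1) {k : E3 → ℝ} (hk : Continuous k)
    (hkc : HasCompactSupport k) :
    IntegrableOn k {y | ⟪ν, y⟫ = 0} μHE[2] ∧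
      ∫ y in {y | ⟪ν, y⟫ = 0}, k y ∂μHE[2] = ∫ w : (ℝ ∙ ν)ᗮ, k w := by
  have hiso : Isometry (Subtype.val : (ℝ ∙ ν)ᗮ → E3) := isometry_subtype_coe
  have hcl : IsClosedEmbedding (Subtype.val : (ℝ ∙ ν)ᗮ → E3) := hiso.isClosedEmbedding
  have hvol : (μHE[2] : Measure (ℝ ∙ ν)ᗮ) = volume := by
    rw [← InnerProductSpace.euclideanHausdorffMeasure_eq_volume, finrank_orthogonal_span hν]
  have hrange : range (Subtype.val : (ℝ ∙ ν)ᗮ → E3) = {y | ⟪ν, y⟫ = 0} := by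
    ext y
    simp [Submodule.mem_orthogonal_singleton_iff_inner_right]
  have hmap := hiso.map_euclideanHausdorffMeasure (d := 2)
  rw [hvol, hrange] at hmap
  constructor
  · rw [IntegrableOn, ← hmap, hcl.measurableEmbedding.integrable_map_iff]
    exact (hk.comp continuous_subtype_val).integrable_of_hasCompactSupport
      (hkc.comp_isClosedEmbedding hcl)
  · rw [← hmap, hcl.measurableEmbedding.integral_map]

/-- The normal and tangential coordinates `(r, w) ↦ r ν + w` preserve volume. -/
lemma exists_measurePreserving_normal_coordinates {ν : E3} (hν : ‖ν‖ = 1) :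
    ∃ θ : ℝ × (ℝ ∙ ν)ᗮ ≃ᵐ E3, MeasurePreserving θ volume volume ∧
      ∀ p, θ p = p.1 • ν + (p.2 : E3) := by
  have h1 := ((ℝ ∙ ν).measurePreserving_measurableEquivProd (0 : E3)).symm
  rw [InnerProductSpace.euclideanHausdorffMeasure_eq_volume] at h1
  let T := LinearIsometryEquiv.toSpanUnitSingleton (𝕜 := ℝ) ν hν
  have h2 : MeasurePreserving (Prod.map T id)
      (volume : Measure (ℝ × (ℝ ∙ ν)ᗮ)) (volume : Measure ((ℝ ∙ ν) × (ℝ ∙ ν)ᗮ)) :=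
    T.measurePreserving.prod (MeasurePreserving.id volume)
  refine ⟨(T.toHomeomorph.toMeasurableEquiv.prodCongr (MeasurableEquiv.refl _)).trans
    ((ℝ ∙ ν).measurableEquivProd (0 : E3)).symm, h1.comp h2, fun p => ?_⟩
  rw [MeasurableEquiv.trans_apply, Submodule.measurableEquivProd_symm_apply]
  change (T p.1 : E3) + (p.2 : E3) + 0 = _
  simp [T]

/-- On a plane the volumic approximation converges to the area integral: in normal and tangential
coordinates the weight is an approximate identity in the normal variable. -/
lemma tendsto_volumic_plane {ζ : ℝ → ℝ} (hζ : IsCutoff ζ) {ν : E3} (hν : ‖ν‖ = 1) {c : ℝ}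
    (hc : 0 < c) {k : E3 → ℝ} (hk : Continuous k) (hkc : HasCompactSupport k) :
    Tendsto (fun ε => ∫ y, k y * (c * (1 / ε * ζ (c * ⟪ν, y⟫ / ε)))) (𝓝[>] 0)
      (𝓝 (∫ y in {y | ⟪ν, y⟫ = 0}, k y ∂μHE[2])) := by
  rw [(integrableOn_plane hν hk hkc).2]
  obtain ⟨θ, hθ, hθp⟩ := exists_measurePreserving_normal_coordinates hν
  have hinner : ∀ p : ℝ × (ℝ ∙ ν)ᗮ, ⟪ν, θ p⟫ = p.1 := fun p => by
    have := Submodule.mem_orthogonal_singleton_iff_inner_right.1 p.2.2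
    rw [hθp, inner_add_right, this, inner_smul_right, real_inner_self_eq_norm_sq, hν]
    simp
  have hθc : Continuous θ := by
    have : (θ : _ → E3) = fun p => p.1 • ν + (p.2 : E3) := funext hθp
    rw [this]; fun_prop
  obtain ⟨R, hR⟩ := hkc.isBounded.subset_closedBall 0
  have hsupp : ∀ p : ℝ × (ℝ ∙ ν)ᗮ, p.2 ∉ Metric.closedBall 0 R → k (θ p) = 0 := fun p hp => by
    by_contra h
    refine hp ?_
    have h1 := hR (subset_tsupport k h)
    simp only [Metric.mem_closedBall, dist_zero_right] at h1 ⊢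
    refine le_trans ?_ h1
    have h2 : ⟪p.1 • ν, (p.2 : E3)⟫ = 0 := by
      rw [inner_smul_left, Submodule.mem_orthogonal_singleton_iff_inner_right.1 p.2.2, mul_zero]
    have h3 := norm_add_sq_eq_norm_sq_add_norm_sq_of_inner_eq_zero _ _ h2
    rw [← hθp] at h3
    have : ‖p.2‖ = ‖(p.2 : E3)‖ := rfl
    rw [this]
    nlinarith [norm_nonneg (θ p), norm_nonneg (p.2 : E3), mul_self_nonneg ‖p.1 • ν‖]
  set ψ : ℝ → ℝ := fun r => ∫ w : (ℝ ∙ ν)ᗮ, k (θ (r, w)) with hψ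
  have hψ' : ψ = fun r => ∫ w in Metric.closedBall (0 : (ℝ ∙ ν)ᗮ) R, k (θ (r, w)) := by
    ext r
    rw [setIntegral_eq_integral_of_forall_compl_eq_zero]
    exact fun w hw => hsupp (r, w) hw
  have hψc : Continuous ψ := by
    rw [hψ']
    exact continuous_parametric_integral_of_continuous (by fun_prop) (isCompact_closedBall _ _)
  obtain ⟨C, hC⟩ := hkc.exists_bound_of_continuous hk
  have hψb : ∀ r, ‖ψ r‖ ≤ C * volume.real (Metric.closedBall (0 : (ℝ ∙ ν)ᗮ) R) := fun r => by
    rw [hψ']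
    exact norm_setIntegral_le_of_norm_le_const (isCompact_closedBall _ _).measure_lt_top
      fun w _ => hC _
  have hζi : Integrable ζ :=
    hζ.continuous.integrable_of_hasCompactSupport hζ.hasCompactSupport
  have key : ∀ ε > 0, ∫ y, k y * (c * (1 / ε * ζ (c * ⟪ν, y⟫ / ε))) =
      ∫ r, ζ r * ψ (ε / c * r) := fun ε hε => by
    have hint : Integrable (fun p : ℝ × (ℝ ∙ ν)ᗮ =>
        k (θ p) * (c * (1 / ε * ζ (c * p.1 / ε)))) := by
      have h := hθ.integrable_comp_emb θ.measurableEmbedding (g := fun y =>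
        k y * (c * (1 / ε * ζ (c * ⟪ν, y⟫ / ε))))
      simp only [Function.comp_def, hinner] at h
      rw [h]
      refine Continuous.integrable_of_hasCompactSupport ?_ hkc.mul_right
      have := hζ.continuous
      fun_prop
    rw [← hθ.integral_comp' (g := fun y => k y * (c * (1 / ε * ζ (c * ⟪ν, y⟫ / ε))))]
    simp only [hinner]
    rw [Measure.volume_eq_prod, integral_prod _ hint]
    have h1 : ∀ r : ℝ, ∫ w : (ℝ ∙ ν)ᗮ, k (θ (r, w)) * (c * (1 / ε * ζ (c * r / ε))) =
        (c / ε) * (fun s => ζ s * ψ (ε / c * s)) (c / ε * r) := fun r => by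
      rw [integral_mul_const]
      have : ε / c * (c / ε * r) = r := by field_simp
      simp only [this]
      rw [show c / ε * r = c * r / ε by ring]
      change ψ r * _ = _
      ring
    simp only [h1]
    rw [integral_const_mul,
      Measure.integral_comp_mul_left (fun s => ζ s * ψ (ε / c * s)), abs_of_pos (by positivity),
      smul_eq_mul, ← mul_assoc, mul_inv_cancel₀ (by positivity), one_mul]
  have hlim : Tendsto (fun ε : ℝ => ∫ r, ζ r * ψ (ε / c * r)) (𝓝[>] 0)
      (𝓝 (∫ r, ζ r * ψ 0)) := by
    refine tendsto_integral_filter_of_dominated_convergence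
      (fun r => ‖ζ r‖ * (C * volume.real (Metric.closedBall (0 : (ℝ ∙ ν)ᗮ) R))) ?_ ?_ ?_ ?_
    · filter_upwards with ε
      have := hζ.continuous
      exact Continuous.aestronglyMeasurable (by fun_prop)
    · filter_upwards with ε
      filter_upwards with r
      rw [norm_mul]
      gcongr
      exact hψb _
    · exact hζi.norm.mul_const _
    · filter_upwards with r
      refine Tendsto.const_mul _ ?_
      have : Tendsto (fun ε : ℝ => ψ (ε / c * r)) (𝓝 0) (𝓝 (ψ (0 / c * r))) :=
        Continuous.tendsto (by fun_prop) 0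
      simp only [zero_div, zero_mul] at this
      exact this.mono_left nhdsWithin_le_nhds
  rw [integral_mul_const, hζ.integral_eq_one, one_mul] at hlim
  have h0 : ψ 0 = ∫ w : (ℝ ∙ ν)ᗮ, k w := by simp [hψ, hθp]
  rw [← h0]
  refine hlim.congr' ?_
  filter_upwards [self_mem_nhdsWithin] with ε hε using (key ε hε).symm

/-! ### Flattening charts of a level set -/

/-- Near a point where `∇φ ≠ 0`, a homeomorphism whose bi-Lipschitz constant is as close to `1` as
desired turns `φ` into a linear function. -/
lemma exists_flattening {φ : E3 → ℝ} (hφ : ContDiff ℝ 1 φ) {x₀ : E3} (h0 : ∇ φ x₀ ≠ 0)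
    {A : NNReal} (hA : 1 < A) :
    ∃ (e : E3 ≃ₜ E3) (ν : E3) (c : ℝ) (U : Set E3), LipschitzWith A e ∧ LipschitzWith A e.symm ∧
      ‖ν‖ = 1 ∧ 0 < c ∧ IsOpen U ∧ x₀ ∈ U ∧
      ∀ x ∈ U, φ x = c * ⟪ν, e x⟫ ∧ ‖∇ φ x‖ ≤ A * c ∧ c ≤ A * ‖∇ φ x‖ := by
  set c : ℝ := ‖∇ φ x₀‖ with hcdef
  have hc : 0 < c := norm_pos_iff.2 h0
  set ν : E3 := c⁻¹ • ∇ φ x₀ with hνdef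
  have hν : ‖ν‖ = 1 := by
    rw [hνdef, norm_smul, norm_inv, Real.norm_of_nonneg hc.le, ← hcdef, inv_mul_cancel₀ hc.ne']
  -- a perturbation of the identity with Lipschitz constant `η` has bi-Lipschitz constants `1 + η`
  -- and `1 / (1 - η)`, both at most `A` for this choice
  set η : NNReal := 1 - A⁻¹ with hη
  have hA0 : 0 < A := zero_lt_one.trans hA
  have hAinv : A⁻¹ < 1 := inv_lt_one_of_one_lt₀ hA
  have hη0 : 0 < η := tsub_pos_of_lt hAinv
  have hηr : (η : ℝ) = 1 - (A : ℝ)⁻¹ := by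
    rw [hη, NNReal.coe_sub hAinv.le]; simp
  have hη1 : η < 1 := by
    rw [← NNReal.coe_lt_coe, hηr]
    simp [hA0]
  -- the scalar correction that turns `⟪ν, ·⟫` into `φ / c` has zero derivative at `x₀`
  have hstrict : HasStrictFDerivAt (fun x => c⁻¹ * φ x - ⟪ν, x⟫) (0 : E3 →L[ℝ] ℝ) x₀ := by
    have h1 := ((hφ.contDiffAt (x := x₀)).hasStrictFDerivAt (by simp)).const_mul c⁻¹
    have h2 := (innerSL ℝ ν).hasStrictFDerivAt (x := x₀)
    have h3 := h1.sub h2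
    refine h3.congr_fderiv ?_
    ext v
    have : ⟪∇ φ x₀, v⟫ = fderiv ℝ φ x₀ v := by simp [gradient]
    simp [hνdef, this]
  obtain ⟨s, hs, hLs⟩ := hstrict.exists_lipschitzOnWith_of_nnnorm_lt η (by simpa using hη0)
  obtain ⟨q, hqL, hqe⟩ := hLs.extend_real
  set Ψ : E3 → E3 := fun x => x + q x • ν with hΨ
  have happ : ApproximatesLinearOn Ψ ((ContinuousLinearEquiv.refl ℝ E3 : E3 ≃L[ℝ] E3) : E3 →L[ℝ] E3)
      univ η := by
    intro x _ y _
    have : Ψ x - Ψ y - ((ContinuousLinearEquiv.refl ℝ E3 : E3 ≃L[ℝ] E3) : E3 →L[ℝ] E3) (x - y) =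
        (q x - q y) • ν := by
      simp only [hΨ, ContinuousLinearEquiv.coe_refl, ContinuousLinearMap.id_apply]
      module
    rw [this, norm_smul, hν, mul_one, ← dist_eq_norm, ← dist_eq_norm]
    exact hqL.dist_le_mul x y
  have hnorm : ‖((ContinuousLinearEquiv.refl ℝ E3).symm : E3 →L[ℝ] E3)‖₊ = 1 := by
    ext
    simp
  have hηc : Subsingleton E3 ∨
      η < ‖((ContinuousLinearEquiv.refl ℝ E3).symm : E3 →L[ℝ] E3)‖₊⁻¹ := by
    right; rw [hnorm]; simpa using hη1
  have hbound : ∀ x y, ‖Ψ x - Ψ y - (x - y)‖ ≤ η * ‖x - y‖ := fun x y => by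
    simpa using happ x (mem_univ _) y (mem_univ _)
  have hAη : 1 + (η : ℝ) ≤ A := by
    have : (0 : ℝ) < A := hA0
    rw [hηr]
    have h2 : (A : ℝ) * (A : ℝ)⁻¹ = 1 := mul_inv_cancel₀ this.ne'
    have h3 : (0 : ℝ) < (A : ℝ)⁻¹ := by positivity
    nlinarith [sq_nonneg ((A : ℝ) - 1)]
  have hgrad : Continuous (∇ φ) :=
    (InnerProductSpace.toDual ℝ E3).symm.continuous.comp (hφ.continuous_fderiv (by simp))
  have hAr : (1 : ℝ) < A := hA
  have hU : ∀ᶠ x in 𝓝 x₀, x ∈ s ∧ ‖∇ φ x‖ < A * c ∧ c < A * ‖∇ φ x‖ := by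
    refine Eventually.and hs (((hgrad.norm.tendsto x₀).eventually_lt_const ?_).and
      (((hgrad.norm.tendsto x₀).const_mul (A : ℝ)).eventually_const_lt ?_)) <;>
    · rw [← hcdef]; nlinarith
  obtain ⟨U, hUs, hUo, hxU⟩ := mem_nhds_iff.1 hU
  refine ⟨happ.toHomeomorph Ψ hηc, ν, c, U, ?_, ?_, hν, hc, hUo, hxU, fun x hx => ?_⟩
  · refine LipschitzWith.of_dist_le_mul fun x y => ?_
    change dist (Ψ x) (Ψ y) ≤ _
    rw [dist_eq_norm, dist_eq_norm]
    have h1 := norm_le_insert' (Ψ x - Ψ y) (x - y)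
    have h2 := hbound x y
    nlinarith [norm_nonneg (x - y)]
  · refine LipschitzWith.of_dist_le_mul fun x y => ?_
    obtain ⟨x, rfl⟩ := (happ.toHomeomorph Ψ hηc).surjective x
    obtain ⟨y, rfl⟩ := (happ.toHomeomorph Ψ hηc).surjective y
    simp only [Homeomorph.symm_apply_apply]
    change dist x y ≤ A * dist (Ψ x) (Ψ y)
    rw [dist_eq_norm, dist_eq_norm]
    have h1 := norm_le_insert (Ψ x - Ψ y) (x - y)
    have h2 := hbound x y
    have h3 : (A : ℝ)⁻¹ * ‖x - y‖ ≤ ‖Ψ x - Ψ y‖ := by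
      have : (A : ℝ)⁻¹ = 1 - η := by rw [hηr]; ring
      rw [this]; linarith
    have hA0r : (0 : ℝ) < A := hA0
    rwa [inv_mul_le_iff₀ hA0r] at h3
  · obtain ⟨hxs, h1, h2⟩ := hUs hx
    refine ⟨?_, h1.le, h2.le⟩
    change φ x = c * ⟪ν, Ψ x⟫
    have : q x = c⁻¹ * φ x - ⟪ν, x⟫ := (hqe hxs).symm
    rw [hΨ]
    simp only [inner_add_right, inner_smul_right, real_inner_self_eq_norm_sq, hν, this]
    field_simp
    ring

/-! ### Convergence of the volumic approximation -/

lemma IsCutoff.eq_zero {ζ : ℝ → ℝ} (hζ : IsCutoff ζ) {r : ℝ} (hr : 1 < |r|) : ζ r = 0 := by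
  by_contra h
  exact absurd (abs_le.2 (hζ.support_subset h)) (not_le.2 hr)

lemma continuous_gradient {φ : E3 → ℝ} (hφ : ContDiff ℝ 1 φ) : Continuous (∇ φ) :=
  (InnerProductSpace.toDual ℝ E3).symm.continuous.comp (hφ.continuous_fderiv (by simp))

lemma continuous_volumicWeight {φ : E3 → ℝ} (hφ : ContDiff ℝ 1 φ) {ζ : ℝ → ℝ} (hζ : IsCutoff ζ)
    (ε : ℝ) : Continuous (volumicWeight ζ ε φ) := by
  have h1 := continuous_gradient hφ
  have h2 := hφ.continuous
  have h3 := hζ.continuous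
  unfold volumicWeight
  fun_prop

/-- Near a regular point, the volumic integral and the surface integral of a nonnegative function
agree in the limit up to a factor `B` as close to `1` as desired. In flattened coordinates the
weight is that of a plane, and both Lebesgue and surface measure are distorted by at most a power
of the bi-Lipschitz constant. -/
lemma exists_local_comparison {φ : E3 → ℝ} (hφ : ContDiff ℝ 1 φ) {x₀ : E3} (h0 : ∇ φ x₀ ≠ 0)
    {B : ℝ} (hB : 1 < B) :
    ∃ U : Set E3, IsOpen U ∧ x₀ ∈ U ∧ ∀ g : E3 → ℝ, Continuous g → HasCompactSupport g →
      tsupport g ⊆ U → (∀ x, 0 ≤ g x) → IntegrableOn g {x | φ x = 0} μHE[2] ∧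
      ∀ ζ, IsCutoff ζ → ∀ δ > 0, ∀ᶠ ε in 𝓝[>] (0 : ℝ),
        ∫ x, g x * volumicWeight ζ ε φ x ≤ B * (∫ x in {x | φ x = 0}, g x ∂μHE[2]) + δ ∧
        ∫ x in {x | φ x = 0}, g x ∂μHE[2] ≤ B * (∫ x, g x * volumicWeight ζ ε φ x) + δ := by
  -- one factor `A` comes from `‖∇φ‖`, three from Lebesgue measure, two from surface measure
  obtain ⟨A, hA, hAB⟩ : ∃ A : NNReal, 1 < A ∧ (A : ℝ) ^ 6 < B := by
    have h1 : ∀ᶠ a in 𝓝[>] (1 : ℝ), a ^ 6 < B := by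
      refine nhdsWithin_le_nhds (((continuous_pow 6).tendsto (1 : ℝ)).eventually_lt_const ?_)
      simpa using hB
    obtain ⟨a, ha, ha1⟩ := (h1.and self_mem_nhdsWithin).exists
    have ha0 : (0 : ℝ) ≤ a := zero_le_one.trans (le_of_lt ha1)
    exact ⟨⟨a, ha0⟩, ha1, ha⟩
  have hA0 : (0 : ℝ) < A := zero_lt_one.trans hA
  obtain ⟨e, ν, c, U, heL, heL', hν, hc, hUo, hxU, hU⟩ := exists_flattening hφ h0 hA
  refine ⟨U, hUo, hxU, fun g hg hgc hgU hg0 => ?_⟩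
  have hzero : ∀ x ∉ U, g x = 0 := fun x hx => image_eq_zero_of_notMem_tsupport fun h => hx (hgU h)
  -- the function `g`, read in the flattened coordinates
  set k : E3 → ℝ := g ∘ e.symm with hkdef
  have hk : Continuous k := hg.comp e.symm.continuous
  have hkc : HasCompactSupport k := hgc.comp_homeomorph e.symm
  have hk0 : ∀ y, 0 ≤ k y := fun y => hg0 _
  have hke : ∀ x, k (e x) = g x := fun x => by simp [hkdef]
  have hS : MeasurableSet {x | φ x = 0} :=
    (isClosed_eq hφ.continuous continuous_const).measurableSet
  have hP : MeasurableSet {y : E3 | ⟪ν, y⟫ = 0} :=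
    (isClosed_eq (by fun_prop) continuous_const).measurableSet
  obtain ⟨hkint, -⟩ := integrableOn_plane hν hk hkc
  have hind : (fun x => ({y : E3 | ⟪ν, y⟫ = 0}.indicator k) (e x)) = {x | φ x = 0}.indicator g := by
    ext x
    by_cases hx : x ∈ U
    · have h1 := (hU x hx).1
      by_cases h2 : φ x = 0
      · have h3 : ⟪ν, e x⟫ = 0 := by
          rw [h2] at h1
          simpa [hc.ne'] using h1.symm
        rw [indicator_of_mem (by exact h3), indicator_of_mem (by exact h2), hke]
      · have h3 : ⟪ν, e x⟫ ≠ 0 := fun h3 => h2 (by rw [h1, h3, mul_zero])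
        rw [indicator_of_notMem (by exact h3), indicator_of_notMem (by exact h2)]
    · simp only [indicator_apply, hke, hzero x hx, ite_self]
  have hG0 : ∀ y, 0 ≤ ({y : E3 | ⟪ν, y⟫ = 0}.indicator k) y := fun y =>
    indicator_nonneg (fun y _ => hk0 y) y
  have hg0' : ∀ y, 0 ≤ ({x | φ x = 0}.indicator g) y := fun y =>
    indicator_nonneg (fun y _ => hg0 y) y
  obtain ⟨hSint, hSle⟩ := integral_comp_homeomorph_le e heL' 2 (hk.measurable.indicator hP) hG0
    ((integrable_indicator_iff hP).2 hkint)
  rw [hind] at hSint hSle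
  obtain ⟨-, hPle⟩ := integral_comp_homeomorph_le e.symm (K := A) (by simpa using heL) 2
    (hg.measurable.indicator hS) hg0' hSint
  have hind' : (fun y => ({x | φ x = 0}.indicator g) (e.symm y)) =
      {y : E3 | ⟪ν, y⟫ = 0}.indicator k := by
    rw [← hind]; ext y; simp
  rw [hind'] at hPle
  rw [integral_indicator hS, integral_indicator hP] at hSle hPle
  refine ⟨(integrable_indicator_iff hS).1 hSint, fun ζ hζ δ hδ => ?_⟩
  set S := ∫ x in {x | φ x = 0}, g x ∂μHE[2]
  set P := ∫ y in {y : E3 | ⟪ν, y⟫ = 0}, k y ∂μHE[2]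
  have hδ' : 0 < δ / A ^ 4 := by positivity
  have hlim := tendsto_volumic_plane hζ hν hc hk hkc
  filter_upwards [hlim.eventually_lt_const (lt_add_of_pos_right P hδ'),
    hlim.eventually_const_lt (sub_lt_self P hδ'), self_mem_nhdsWithin] with ε h1 h2 hε
  have hε : 0 < ε := hε
  set F : E3 → ℝ := fun y => k y * (c * (1 / ε * ζ (c * ⟪ν, y⟫ / ε))) with hF
  set M := ∫ x, g x * volumicWeight ζ ε φ x with hM
  have hF0 : ∀ y, 0 ≤ F y := fun y => by
    have := hk0 y; have := hζ.nonneg (c * ⟪ν, y⟫ / ε); positivity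
  have hζcont := hζ.continuous
  have hFc : Continuous F := by fun_prop
  have hFi : Integrable F := hFc.integrable_of_hasCompactSupport hkc.mul_right
  have hvol : (volume : Measure E3) = μHE[3] :=
    (EuclideanSpace.euclideanHausdorffMeasure_eq_volume 3).symm
  obtain ⟨hei, hele⟩ := integral_comp_homeomorph_le e heL' 3 hFc.measurable hF0 (hvol ▸ hFi)
  obtain ⟨-, hele'⟩ := integral_comp_homeomorph_le e.symm (K := A) (by simpa using heL) 3
    (F := fun x => F (e x)) (hFc.comp e.continuous).measurable (fun x => hF0 (e x)) hei
  simp only [Homeomorph.apply_symm_apply] at hele'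
  rw [← hvol] at hele hele' hei
  have hMi : Integrable (fun x => g x * volumicWeight ζ ε φ x) :=
    (hg.mul (continuous_volumicWeight hφ hζ ε)).integrable_of_hasCompactSupport hgc.mul_right
  have hMe : M ≤ A * ∫ x, F (e x) := by
    rw [← integral_const_mul]
    refine integral_mono hMi (hei.const_mul _) fun x => ?_
    by_cases hx : x ∈ U
    · obtain ⟨ha, hb, -⟩ := hU x hx
      have h3 := hζ.nonneg (φ x / ε)
      simp only [hF, hke, volumicWeight, ← ha]
      calc g x * (‖∇ φ x‖ * (1 / ε * ζ (φ x / ε))) ≤ g x * ((A * c) * (1 / ε * ζ (φ x / ε))) := by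
            have := hg0 x; gcongr
        _ = _ := by ring
    · simp [hF, hke, hzero x hx]
  have heM : ∫ x, F (e x) ≤ A * M := by
    rw [hM, ← integral_const_mul]
    refine integral_mono hei (hMi.const_mul _) fun x => ?_
    by_cases hx : x ∈ U
    · obtain ⟨ha, -, hb⟩ := hU x hx
      have h3 := hζ.nonneg (φ x / ε)
      simp only [hF, hke, volumicWeight, ← ha]
      calc g x * (c * (1 / ε * ζ (φ x / ε))) ≤ g x * ((A * ‖∇ φ x‖) * (1 / ε * ζ (φ x / ε))) := by
            have := hg0 x; gcongr
        _ = _ := by ring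
    · simp [hF, hke, hzero x hx]
  have hP0 : 0 ≤ S := integral_nonneg hg0
  have hM0 : 0 ≤ M := by
    refine integral_nonneg fun x => ?_
    have := hg0 x; have := hζ.nonneg (φ x / ε)
    simp only [volumicWeight]; positivity
  have hA1 : (1 : ℝ) ≤ A := hA.le
  have hcancel : (A : ℝ) ^ 4 * (δ / A ^ 4) = δ := by field_simp
  have hδA : (A : ℝ) ^ 2 * (δ / A ^ 4) ≤ δ := by
    rw [← hcancel]
    have : (A : ℝ) ^ 2 ≤ A ^ 4 := pow_le_pow_right₀ hA1 (by norm_num)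
    rw [hcancel]
    calc (A : ℝ) ^ 2 * (δ / A ^ 4) ≤ A ^ 4 * (δ / A ^ 4) := by gcongr
      _ = δ := hcancel
  set Pε := ∫ y, F y
  constructor
  · calc M ≤ A * (A ^ 3 * Pε) := hMe.trans (by gcongr)
      _ = A ^ 4 * Pε := by ring
      _ ≤ A ^ 4 * (A ^ 2 * S + δ / A ^ 4) := by
          gcongr
          linarith
      _ = A ^ 6 * S + δ := by rw [mul_add, hcancel]; ring
      _ ≤ B * S + δ := by gcongr
  · calc S ≤ A ^ 2 * P := hSle
      _ ≤ A ^ 2 * (A ^ 3 * (A * M) + δ / A ^ 4) := by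
          gcongr
          have : Pε ≤ A ^ 3 * (A * M) := hele'.trans (by gcongr)
          linarith
      _ ≤ A ^ 6 * M + δ := by
          rw [mul_add]
          refine add_le_add (le_of_eq (by ring)) hδA
      _ ≤ B * M + δ := by gcongr

/-- The comparison of volumic and surface integrals, made global by a partition of unity. -/
lemma volumic_comparison {φ : E3 → ℝ} (hφ : ContDiff ℝ 1 φ) {g : E3 → ℝ} (hg : Continuous g)
    (hgc : HasCompactSupport g) (hreg : ∀ x ∈ tsupport g, ∇ φ x ≠ 0) (hg0 : ∀ x, 0 ≤ g x)
    {B : ℝ} (hB : 1 < B) : IntegrableOn g {x | φ x = 0} μHE[2] ∧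
      ∀ ζ, IsCutoff ζ → ∀ δ > 0, ∀ᶠ ε in 𝓝[>] (0 : ℝ),
        ∫ x, g x * volumicWeight ζ ε φ x ≤ B * (∫ x in {x | φ x = 0}, g x ∂μHE[2]) + δ ∧
        ∫ x in {x | φ x = 0}, g x ∂μHE[2] ≤ B * (∫ x, g x * volumicWeight ζ ε φ x) + δ := by
  choose! U hUo hxU hU using fun x (hx : x ∈ tsupport g) =>
    exists_local_comparison hφ (hreg x hx) hB
  obtain ⟨s, hs, hcov⟩ := hgc.isCompact.elim_finite_subcover_image hUo
    (fun x hx => mem_iUnion₂.2 ⟨x, hx, hxU x hx⟩)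
  obtain ⟨hsf, hcov⟩ := hcov
  obtain ⟨n, ⟨idx⟩⟩ : ∃ n, Nonempty (hsf.toFinset ≃ Fin n) := ⟨_, ⟨hsf.toFinset.equivFin⟩⟩
  have hmem : ∀ i : Fin n, ((idx.symm i : E3)) ∈ tsupport g := fun i =>
    hs (hsf.mem_toFinset.1 (idx.symm i).2)
  obtain ⟨ρ, hρs, hρ1, hρI, -⟩ := exists_continuous_sum_one_of_isOpen_isCompact
    (s := fun i : Fin n => U (idx.symm i)) (fun i => hUo _ (hmem i)) hgc.isCompact (by
      intro x hx
      obtain ⟨y, hy, hxy⟩ := mem_iUnion₂.1 (hcov hx)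
      refine mem_iUnion.2 ⟨idx ⟨y, hsf.mem_toFinset.2 hy⟩, ?_⟩
      simpa using hxy)
  have hloc : ∀ i : Fin n, IntegrableOn (fun x => ρ i x * g x) {x | φ x = 0} μHE[2] ∧
      ∀ ζ, IsCutoff ζ → ∀ δ > 0, ∀ᶠ ε in 𝓝[>] (0 : ℝ),
        ∫ x, ρ i x * g x * volumicWeight ζ ε φ x ≤
          B * (∫ x in {x | φ x = 0}, ρ i x * g x ∂μHE[2]) + δ ∧
        ∫ x in {x | φ x = 0}, ρ i x * g x ∂μHE[2] ≤
          B * (∫ x, ρ i x * g x * volumicWeight ζ ε φ x) + δ := fun i =>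
    hU _ (hmem i) (fun x => ρ i x * g x) ((ρ i).continuous.mul hg) hgc.mul_left
      ((tsupport_mul_subset_left).trans (hρs i)) fun x => mul_nonneg (hρI i x).1 (hg0 x)
  have hsum : ∀ x, g x = ∑ i, ρ i x * g x := fun x => by
    rw [← Finset.sum_mul]
    by_cases hx : x ∈ tsupport g
    · have := hρ1 hx
      simp only [Finset.sum_apply, Pi.one_apply] at this
      rw [this, one_mul]
    · rw [image_eq_zero_of_notMem_tsupport hx, mul_zero]
  have hgi : IntegrableOn g {x | φ x = 0} μHE[2] := by
    have : g = fun x => ∑ i, ρ i x * g x := funext hsum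
    rw [this]
    exact integrable_finsetSum _ fun i _ => (hloc i).1
  refine ⟨hgi, fun ζ hζ δ hδ => ?_⟩
  have hS : ∫ x in {x | φ x = 0}, g x ∂μHE[2] =
      ∑ i, ∫ x in {x | φ x = 0}, ρ i x * g x ∂μHE[2] := by
    rw [← integral_finsetSum _ fun i _ => (hloc i).1]
    exact integral_congr_ae (ae_of_all _ hsum)
  have hM : ∀ ε, ∫ x, g x * volumicWeight ζ ε φ x =
      ∑ i, ∫ x, ρ i x * g x * volumicWeight ζ ε φ x := fun ε => by
    rw [← integral_finsetSum]
    · refine integral_congr_ae (ae_of_all _ fun x => ?_)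
      change g x * _ = ∑ i, ρ i x * g x * _
      rw [← Finset.sum_mul, ← hsum]
    · intro i _
      refine Continuous.integrable_of_hasCompactSupport ?_ (hgc.mul_left.mul_right)
      exact (((ρ i).continuous.mul hg).mul (continuous_volumicWeight hφ hζ ε))
  have hn : 0 < δ / (n + 1 : ℝ) := by positivity
  have hnδ : ∑ _i : Fin n, δ / (n + 1 : ℝ) ≤ δ := by
    rw [Finset.sum_const, Finset.card_univ, Fintype.card_fin, nsmul_eq_mul, mul_div_assoc',
      div_le_iff₀ (by positivity)]
    nlinarith
  filter_upwards [eventually_all.2 fun i => (hloc i).2 ζ hζ _ hn] with ε hε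
  rw [hS, hM, Finset.mul_sum, Finset.mul_sum]
  refine ⟨(Finset.sum_le_sum fun i _ => (hε i).1).trans ?_,
    (Finset.sum_le_sum fun i _ => (hε i).2).trans ?_⟩ <;>
  · rw [Finset.sum_add_distrib]
    gcongr

lemma tendsto_volumic_nonneg {φ : E3 → ℝ} (hφ : ContDiff ℝ 1 φ) {g : E3 → ℝ} (hg : Continuous g)
    (hgc : HasCompactSupport g) (hreg : ∀ x ∈ tsupport g, ∇ φ x ≠ 0) (hg0 : ∀ x, 0 ≤ g x)
    {ζ : ℝ → ℝ} (hζ : IsCutoff ζ) :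
    Tendsto (fun ε => ∫ x, g x * volumicWeight ζ ε φ x) (𝓝[>] 0)
      (𝓝 (∫ x in {x | φ x = 0}, g x ∂μHE[2])) := by
  set S := ∫ x in {x | φ x = 0}, g x ∂μHE[2]
  have hS0 : 0 ≤ S := integral_nonneg hg0
  refine tendsto_order.2 ⟨fun a ha => ?_, fun b hb => ?_⟩
  · set δ := (S - a) / 4 with hδdef
    have hδ : 0 < δ := by rw [hδdef]; linarith
    set B := 1 + δ / (S + |a| + 1) with hBdef
    have hpos : 0 < S + |a| + 1 := by positivity
    have hB : 1 < B := by rw [hBdef]; linarith [div_pos hδ hpos]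
    filter_upwards [(volumic_comparison hφ hg hgc hreg hg0 hB).2 ζ hζ δ hδ] with ε hε
    by_contra hcon
    push Not at hcon
    have h1 : S ≤ B * a + δ := hε.2.trans (by gcongr)
    have h2 : δ / (S + |a| + 1) * a ≤ δ := by
      rw [div_mul_eq_mul_div, div_le_iff₀ hpos]
      gcongr
      linarith [le_abs_self a]
    have h3 : B * a = a + δ / (S + |a| + 1) * a := by rw [hBdef]; ring
    linarith
  · set δ := (b - S) / 4 with hδdef
    have hδ : 0 < δ := by rw [hδdef]; linarith
    set B := 1 + δ / (S + 1) with hBdef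
    have hpos : 0 < S + 1 := by positivity
    have hB : 1 < B := by rw [hBdef]; linarith [div_pos hδ hpos]
    filter_upwards [(volumic_comparison hφ hg hgc hreg hg0 hB).2 ζ hζ δ hδ] with ε hε
    have h2 : δ / (S + 1) * S ≤ δ := by
      rw [div_mul_eq_mul_div, div_le_iff₀ hpos]
      gcongr
      linarith
    have h3 : B * S = S + δ / (S + 1) * S := by rw [hBdef]; ring
    linarith [hε.1]

/-- The volumic weights converge weakly to the surface measure of a regular level set. -/
lemma tendsto_volumic {φ : E3 → ℝ} (hφ : ContDiff ℝ 1 φ) {g : E3 → ℝ} (hg : Continuous g)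
    (hgc : HasCompactSupport g) (hreg : ∀ x ∈ tsupport g, ∇ φ x ≠ 0) :
    IntegrableOn g {x | φ x = 0} μHE[2] ∧ ∀ ζ, IsCutoff ζ →
    Tendsto (fun ε => ∫ x, g x * volumicWeight ζ ε φ x) (𝓝[>] 0)
      (𝓝 (∫ x in {x | φ x = 0}, g x ∂μHE[2])) := by
  have hp : ∀ h : E3 → ℝ, (∀ x, g x = 0 → h x = 0) → tsupport h ⊆ tsupport g := fun h hh =>
    closure_mono fun x hx hgx => hx (hh x hgx)
  have h1s : tsupport (fun x => max (g x) 0) ⊆ tsupport g := hp _ fun x hx => by simp [hx]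
  have h2s : tsupport (fun x => max (-g x) 0) ⊆ tsupport g := hp _ fun x hx => by simp [hx]
  have h1c : HasCompactSupport fun x => max (g x) 0 := hgc.of_isClosed_subset isClosed_closure h1s
  have h2c : HasCompactSupport fun x => max (-g x) 0 := hgc.of_isClosed_subset isClosed_closure h2s
  have h1 : Continuous fun x => max (g x) 0 := by fun_prop
  have h2 : Continuous fun x => max (-g x) 0 := by fun_prop
  have hsplit : ∀ x, g x = max (g x) 0 - max (-g x) 0 := fun x => by
    rcases le_total (g x) 0 with h | h <;> simp [h]
  have hi1 := (volumic_comparison hφ h1 h1c (fun x hx => hreg x (h1s hx))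
    (fun x => le_max_right _ _) one_lt_two).1
  have hi2 := (volumic_comparison hφ h2 h2c (fun x hx => hreg x (h2s hx))
    (fun x => le_max_right _ _) one_lt_two).1
  constructor
  · refine (hi1.sub hi2).congr (ae_of_all _ fun x => ?_)
    exact (hsplit x).symm
  intro ζ hζ
  have hl1 := tendsto_volumic_nonneg hφ h1 h1c (fun x hx => hreg x (h1s hx))
    (fun x => le_max_right _ _) hζ
  have hl2 := tendsto_volumic_nonneg hφ h2 h2c (fun x hx => hreg x (h2s hx))
    (fun x => le_max_right _ _) hζ
  have hl := hl1.sub hl2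
  rw [← integral_sub hi1 hi2] at hl
  simp only [← hsplit] at hl
  refine hl.congr fun ε => ?_
  have hw := continuous_volumicWeight hφ hζ ε
  have hj1 : Integrable fun x => max (g x) 0 * volumicWeight ζ ε φ x :=
    (h1.mul hw).integrable_of_hasCompactSupport h1c.mul_right
  have hj2 : Integrable fun x => max (-g x) 0 * volumicWeight ζ ε φ x :=
    (h2.mul hw).integrable_of_hasCompactSupport h2c.mul_right
  rw [← integral_sub hj1 hj2]
  simp only [← sub_mul, ← hsplit]

/-! ### Integrals over time slices -/

lemma clm_apply_eq_sum (L : E3 →L[ℝ] ℝ) (v : E3) :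
    L v = ∑ i : Fin 3, v i * L (EuclideanSpace.single i 1) := by
  have h1 : v = ∑ i : Fin 3, v i • EuclideanSpace.single i (1 : ℝ) := by
    rw [Fin.sum_univ_three]
    ext j
    fin_cases j <;> simp
  conv_lhs => rw [h1]
  rw [map_sum]
  exact Finset.sum_congr rfl fun i _ => by rw [map_smul, smul_eq_mul]

/-- The spatial divergence `∑ i, ∂Yᵢ/∂xᵢ` of a time-dependent vector field. -/
noncomputable def spatialDiv (Y : ℝ × E3 → E3) (p : ℝ × E3) : ℝ :=
  ∑ i : Fin 3, fderiv ℝ Y p (0, EuclideanSpace.single i 1) i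

lemma hasCompactSupport_slice {F : Type*} [Zero F] {G : ℝ × E3 → F} (hG : HasCompactSupport G)
    (t : ℝ) : HasCompactSupport fun x => G (t, x) :=
  HasCompactSupport.intro (hG.isCompact.image continuous_snd) fun x hx =>
    image_eq_zero_of_notMem_tsupport fun h => hx ⟨(t, x), h, rfl⟩

lemma integrable_slice {G : ℝ × E3 → ℝ} (hG : Continuous G) (hGc : HasCompactSupport G) (t : ℝ) :
    Integrable fun x => G (t, x) :=
  (hG.comp (by fun_prop : Continuous fun x : E3 => (t, x))).integrable_of_hasCompactSupport
    (hasCompactSupport_slice hGc t)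

lemma exists_integral_slice_le {G : ℝ × E3 → ℝ} (hG : Continuous G) (hGc : HasCompactSupport G) :
    ∃ C, 0 ≤ C ∧ ∀ t, ∫ x, |G (t, x)| ≤ C := by
  obtain ⟨M, hM⟩ := hGc.exists_bound_of_continuous hG
  have hK : IsCompact (Prod.snd '' tsupport G) := hGc.isCompact.image continuous_snd
  have hM0 : 0 ≤ M := (norm_nonneg _).trans (hM 0)
  refine ⟨M * volume.real (Prod.snd '' tsupport G), by positivity, fun t => ?_⟩
  have h0 : ∀ x ∉ Prod.snd '' tsupport G, |G (t, x)| = 0 := fun x hx => by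
    rw [image_eq_zero_of_notMem_tsupport fun h => hx ⟨(t, x), h, rfl⟩, abs_zero]
  rw [← setIntegral_eq_integral_of_forall_compl_eq_zero h0]
  have h1 : ∀ x ∈ Prod.snd '' tsupport G, ‖|G (t, x)|‖ ≤ M := fun x _ => by
    simpa using hM (t, x)
  exact (le_abs_self _).trans (norm_setIntegral_le_of_norm_le_const hK.measure_lt_top h1)

lemma hasDerivAt_integral_slice {G : ℝ × E3 → ℝ} (hG : ContDiff ℝ 1 G) (hGc : HasCompactSupport G)
    (t : ℝ) : HasDerivAt (fun s => ∫ x, G (s, x)) (∫ x, fderiv ℝ G (t, x) (1, 0)) t := by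
  have hd : Continuous fun p => fderiv ℝ G p (1, 0) :=
    (hG.continuous_fderiv (by simp)).clm_apply continuous_const
  have hdc : HasCompactSupport fun p => fderiv ℝ G p (1, 0) := hGc.fderiv_apply (𝕜 := ℝ) _
  obtain ⟨M, hM⟩ := hdc.exists_bound_of_continuous hd
  have hK : IsCompact (Prod.snd '' tsupport G) := hGc.isCompact.image continuous_snd
  refine (hasDerivAt_integral_of_dominated_loc_of_deriv_le (s := univ)
    (F' := fun s x => fderiv ℝ G (s, x) (1, 0))
    (bound := (Prod.snd '' tsupport G).indicator fun _ => M) univ_mem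
    (Eventually.of_forall fun s => (integrable_slice hG.continuous hGc s).aestronglyMeasurable)
    (integrable_slice hG.continuous hGc t) (integrable_slice hd hdc t).aestronglyMeasurable
    (ae_of_all _ fun x s _ => ?_) ?_ (ae_of_all _ fun x s _ => ?_)).2
  · by_cases hx : x ∈ Prod.snd '' tsupport G
    · rw [indicator_of_mem hx]; exact hM _
    · rw [indicator_of_notMem hx]
      have h1 : (s, x) ∉ tsupport G := fun h => hx ⟨(s, x), h, rfl⟩
      have h2 : fderiv ℝ G (s, x) = 0 :=
        image_eq_zero_of_notMem_tsupport fun h => h1 (tsupport_fderiv_subset ℝ h)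
      simp [h2]
  · exact (integrable_indicator_iff hK.measurableSet).2 (integrableOn_const hK.measure_lt_top.ne)
  · have h1 := (hG.differentiable (by simp) (s, x)).hasFDerivAt
    have h2 : HasDerivAt (fun r : ℝ => (r, x)) ((1 : ℝ), (0 : E3)) s :=
      (hasDerivAt_id s).prodMk (hasDerivAt_const s x)
    exact h1.comp_hasDerivAt s h2

lemma hasFDerivAt_slice {F : Type*} [NormedAddCommGroup F] [NormedSpace ℝ F] {G : ℝ × E3 → F}
    {t : ℝ} {x : E3} (hG : DifferentiableAt ℝ G (t, x)) :
    HasFDerivAt (fun y => G (t, y)) ((fderiv ℝ G (t, x)).comp (.inr ℝ ℝ E3)) x :=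
  hG.hasFDerivAt.comp x (hasFDerivAt_prodMk_right t x)

lemma divergence_slice {Y : ℝ × E3 → E3} {t : ℝ} {x : E3} (hY : DifferentiableAt ℝ Y (t, x)) :
    divergence (fun y => Y (t, y)) x = spatialDiv Y (t, x) := by
  simp [divergence, spatialDiv, (hasFDerivAt_slice hY).fderiv]

lemma integral_spatialDiv {Y : ℝ × E3 → E3} (hY : ContDiff ℝ 1 Y) (hYc : HasCompactSupport Y)
    (t : ℝ) : ∫ x, spatialDiv Y (t, x) = 0 := by
  have hd : ∀ i : Fin 3, Continuous fun p => fderiv ℝ Y p (0, EuclideanSpace.single i 1) i :=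
    fun i => by
      have h1 : Continuous fun p => fderiv ℝ Y p (0, EuclideanSpace.single i 1) :=
        (hY.continuous_fderiv (by simp)).clm_apply continuous_const
      exact (EuclideanSpace.proj (𝕜 := ℝ) i).continuous.comp h1
  have hdc : ∀ i : Fin 3,
      HasCompactSupport fun p => fderiv ℝ Y p (0, EuclideanSpace.single i 1) i := fun i =>
    (hYc.fderiv_apply (𝕜 := ℝ) (0, EuclideanSpace.single i 1)).comp_left
      (g := fun v : E3 => v i) rfl
  simp only [spatialDiv]
  rw [integral_finsetSum _ fun i _ => integrable_slice (hd i) (hdc i) t]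
  refine Finset.sum_eq_zero fun i _ => ?_
  -- integrate the derivative of the `i`-th component against the constant `1`
  have hYi : Continuous fun p => Y p i :=
    (EuclideanSpace.proj (𝕜 := ℝ) i).continuous.comp hY.continuous
  have hYic : HasCompactSupport fun p => Y p i := hYc.comp_left (g := fun v : E3 => v i) rfl
  have h := integral_bilinear_hasLineDerivAt_right_eq_neg_left_of_integrable
    (μ := (volume : Measure E3)) (B := ContinuousLinearMap.mul ℝ ℝ)
    (f := fun _ => (1 : ℝ)) (f' := fun _ => 0) (g := fun x => Y (t, x) i)
    (g' := fun x => fderiv ℝ Y (t, x) (0, EuclideanSpace.single i 1) i)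
    (v := EuclideanSpace.single i 1) (by simp)
    (by simpa using integrable_slice (hd i) (hdc i) t)
    (by simpa using integrable_slice hYi hYic t)
    (fun x _ => (hasFDerivAt_const (1 : ℝ) x).hasLineDerivAt _)
    (fun x _ => by
      have h1 := hasFDerivAt_slice (hY.differentiable (by simp) (t, x))
      have h2 := ((EuclideanSpace.proj (𝕜 := ℝ) i).hasFDerivAt.comp x h1).hasLineDerivAt
        (EuclideanSpace.single i 1)
      simpa [Function.comp_def] using h2)
  simpa using h

/-! ### Admissible functions -/

/-- A smooth function of time and space with compact support in the set `N`. -/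
structure Admissible {F : Type*} [NormedAddCommGroup F] [NormedSpace ℝ F] (N : Set (ℝ × E3))
    (a : ℝ × E3 → F) : Prop where
  contDiff : ContDiff ℝ ∞ a
  hasCompactSupport : HasCompactSupport a
  tsupport_subset : tsupport a ⊆ N

section

variable {F : Type*} [NormedAddCommGroup F] [NormedSpace ℝ F] {N : Set (ℝ × E3)}

lemma contDiff_of_tsupport {n : ℕ∞ω} {a : ℝ × E3 → F} (h : ∀ p ∈ tsupport a, ContDiffAt ℝ n a p) :
    ContDiff ℝ n a := by
  refine contDiff_iff_contDiffAt.2 fun p => ?_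
  by_cases hp : p ∈ tsupport a
  · exact h p hp
  · exact contDiffAt_const.congr_of_eventuallyEq (notMem_tsupport_iff_eventuallyEq.1 hp)

lemma Admissible.smul (hN : IsOpen N) {a : ℝ × E3 → ℝ} (ha : Admissible N a) {v : ℝ × E3 → F}
    (hv : ContDiffOn ℝ ∞ v N) : Admissible N fun p => a p • v p := by
  have hs : tsupport (fun p => a p • v p) ⊆ tsupport a := tsupport_smul_subset_left a v
  refine ⟨contDiff_of_tsupport fun p hp => ?_, ha.hasCompactSupport.smul_right,
    hs.trans ha.tsupport_subset⟩
  exact ha.contDiff.contDiffAt.smul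
    (hv.contDiffAt (hN.mem_nhds (ha.tsupport_subset (hs hp))))

lemma Admissible.add {a b : ℝ × E3 → F} (ha : Admissible N a) (hb : Admissible N b) :
    Admissible N fun p => a p + b p :=
  ⟨ha.contDiff.add hb.contDiff, ha.hasCompactSupport.add hb.hasCompactSupport,
    (tsupport_add a b).trans (union_subset ha.tsupport_subset hb.tsupport_subset)⟩

lemma Admissible.fderiv_apply {a : ℝ × E3 → F} (ha : Admissible N a) (v : ℝ × E3) :
    Admissible N fun p => fderiv ℝ a p v :=
  ⟨(ha.contDiff.fderiv_right (m := ∞) (by simp)).clm_apply contDiff_const,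
    ha.hasCompactSupport.fderiv_apply (𝕜 := ℝ) v,
    (tsupport_fderiv_apply_subset ℝ v).trans ha.tsupport_subset⟩

lemma Admissible.spatialDiv {Y : ℝ × E3 → E3} (hY : Admissible N Y) :
    Admissible N (spatialDiv Y) := by
  have h : ∀ i : Fin 3,
      Admissible N fun p => fderiv ℝ Y p (0, EuclideanSpace.single i 1) i := fun i => by
    have h1 := hY.fderiv_apply (0, EuclideanSpace.single i 1)
    refine ⟨(EuclideanSpace.proj (𝕜 := ℝ) i).contDiff.comp h1.contDiff,
      h1.hasCompactSupport.comp_left (g := fun v : E3 => v i) rfl, ?_⟩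
    refine (closure_mono ?_).trans h1.tsupport_subset
    intro p hp hp0
    apply hp
    simp [hp0]
  have h3 := ((h 0).add (h 1)).add (h 2)
  have : LevelSet.spatialDiv Y = _ := funext fun p => Fin.sum_univ_three _
  rwa [this]

end

/-! ### Weighted integrals and their time derivatives -/

section Transport

variable {N : Set (ℝ × E3)} {Φ : ℝ × E3 → ℝ}

/-- `Φ` is smooth on `N` only, but `h(Φ) a` is differentiable everywhere since `a` vanishes
near the complement of `N`. -/
lemma contDiff_smul_comp {F : Type*} [NormedAddCommGroup F] [NormedSpace ℝ F] (hN : IsOpen N)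
    (hΦ : ContDiffOn ℝ ∞ Φ N) {a : ℝ × E3 → F} (ha : Admissible N a) {h : ℝ → ℝ}
    (hh : ContDiff ℝ 1 h) : ContDiff ℝ 1 fun p => h (Φ p) • a p := by
  have hs : tsupport (fun p => h (Φ p) • a p) ⊆ tsupport a :=
    tsupport_smul_subset_right (fun p => h (Φ p)) a
  refine contDiff_of_tsupport fun p hp => ?_
  have h1 : ContDiffAt ℝ 1 Φ p :=
    (hΦ.contDiffAt (hN.mem_nhds (ha.tsupport_subset (hs hp)))).of_le (by simp)
  exact (hh.contDiffAt.comp p h1).smul (ha.contDiff.contDiffAt.of_le (by simp))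

lemma hasCompactSupport_smul_comp {F : Type*} [NormedAddCommGroup F] [NormedSpace ℝ F]
    {a : ℝ × E3 → F} (ha : HasCompactSupport a) (b : ℝ × E3 → ℝ) :
    HasCompactSupport fun p => b p • a p :=
  HasCompactSupport.smul_left (f := b) (f' := a) ha

lemma continuous_weighted (hN : IsOpen N) (hΦ : ContDiffOn ℝ ∞ Φ N) {a : ℝ × E3 → ℝ}
    (ha : Admissible N a) {h : ℝ → ℝ} (hh : Continuous h) :
    Continuous fun p => a p * h (Φ p) := by
  refine continuous_iff_continuousAt.2 fun p => ?_
  by_cases hp : p ∈ tsupport a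
  · have h1 : ContinuousAt Φ p :=
      hΦ.continuousOn.continuousAt (hN.mem_nhds (ha.tsupport_subset hp))
    exact ha.contDiff.continuous.continuousAt.mul (hh.continuousAt.comp h1)
  · refine (continuousAt_const (y := (0 : ℝ))).congr ?_
    filter_upwards [notMem_tsupport_iff_eventuallyEq.1 hp] with q hq
    simp [hq]

lemma integrable_weighted (hN : IsOpen N) (hΦ : ContDiffOn ℝ ∞ Φ N) {a : ℝ × E3 → ℝ}
    (ha : Admissible N a) {h : ℝ → ℝ} (hh : Continuous h) (t : ℝ) :
    Integrable fun x => a (t, x) * h (Φ (t, x)) :=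
  integrable_slice (continuous_weighted hN hΦ ha hh) ha.hasCompactSupport.mul_right t

lemma fderiv_smul_comp {F : Type*} [NormedAddCommGroup F] [NormedSpace ℝ F] (hN : IsOpen N)
    (hΦ : ContDiffOn ℝ ∞ Φ N) {a : ℝ × E3 → F} (ha : Admissible N a) {h : ℝ → ℝ}
    (hh : ContDiff ℝ 1 h) (p v : ℝ × E3) :
    fderiv ℝ (fun p => h (Φ p) • a p) p v =
      h (Φ p) • fderiv ℝ a p v + (deriv h (Φ p) * fderiv ℝ Φ p v) • a p := by
  by_cases hp : p ∈ tsupport a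
  · have h1 : HasFDerivAt Φ (fderiv ℝ Φ p) p :=
      ((hΦ.contDiffAt (hN.mem_nhds (ha.tsupport_subset hp))).differentiableAt
        (by simp)).hasFDerivAt
    have h2 : HasDerivAt h (deriv h (Φ p)) (Φ p) := (hh.differentiable (by simp) _).hasDerivAt
    have h3 := (h2.comp_hasFDerivAt p h1).smul
      (ha.contDiff.differentiable (by simp) p).hasFDerivAt
    have h4 : fderiv ℝ (fun p => h (Φ p) • a p) p = _ := h3.fderiv
    rw [h4]
    simp
  · have h1 := notMem_tsupport_iff_eventuallyEq.1 hp
    have h2 : (fun p => h (Φ p) • a p) =ᶠ[𝓝 p] fun _ => 0 := by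
      filter_upwards [h1] with q hq
      simp [hq]
    rw [h2.fderiv_eq, h1.fderiv_eq, h1.eq_of_nhds]
    simp

lemma spatialDiv_smul_comp (hN : IsOpen N) (hΦ : ContDiffOn ℝ ∞ Φ N) {Y : ℝ × E3 → E3}
    (hY : Admissible N Y) {h : ℝ → ℝ} (hh : ContDiff ℝ 1 h) (p : ℝ × E3) :
    spatialDiv (fun p => h (Φ p) • Y p) p =
      h (Φ p) * spatialDiv Y p + deriv h (Φ p) * fderiv ℝ Φ p (0, Y p) := by
  have hlin : fderiv ℝ Φ p (0, Y p) = _ :=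
    clm_apply_eq_sum ((fderiv ℝ Φ p).comp (.inr ℝ ℝ E3)) (Y p)
  simp only [ContinuousLinearMap.comp_apply, ContinuousLinearMap.inr_apply] at hlin
  simp only [spatialDiv, fderiv_smul_comp hN hΦ hY hh, hlin, Finset.mul_sum,
    ← Finset.sum_add_distrib]
  refine Finset.sum_congr rfl fun i _ => ?_
  simp only [PiLp.add_apply, PiLp.smul_apply, smul_eq_mul]
  ring

/-- If the flux `Y` balances the motion of the level sets, the time derivative of the integral of
`a h(Φ)` is the integral of `(∂ₜ a + div Y) h(Φ)`: the terms with `h'` cancel, and `div (h(Φ) Y)`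
has integral zero. -/
lemma hasDerivAt_weighted (hN : IsOpen N) (hΦ : ContDiffOn ℝ ∞ Φ N) {a : ℝ × E3 → ℝ}
    (ha : Admissible N a) {Y : ℝ × E3 → E3} (hY : Admissible N Y)
    (hbal : ∀ p ∈ N, a p * fderiv ℝ Φ p (1, 0) + fderiv ℝ Φ p (0, Y p) = 0)
    {h : ℝ → ℝ} (hh : ContDiff ℝ 1 h) (t : ℝ) :
    HasDerivAt (fun s => ∫ x, a (s, x) * h (Φ (s, x)))
      (∫ x, (fderiv ℝ a (t, x) (1, 0) + spatialDiv Y (t, x)) * h (Φ (t, x))) t := by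
  have hG := contDiff_smul_comp hN hΦ ha hh
  have hGc : HasCompactSupport fun p => h (Φ p) • a p :=
    hasCompactSupport_smul_comp ha.hasCompactSupport _
  have hZ := contDiff_smul_comp hN hΦ hY hh
  have hZc : HasCompactSupport fun p => h (Φ p) • Y p :=
    hasCompactSupport_smul_comp hY.hasCompactSupport _
  have h1 := hasDerivAt_integral_slice hG hGc t
  have h2 := integral_spatialDiv hZ hZc t
  have hpt : ∀ p, fderiv ℝ (fun p => h (Φ p) • a p) p (1, 0) =
      (fderiv ℝ a p (1, 0) + spatialDiv Y p) * h (Φ p)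
        - spatialDiv (fun p => h (Φ p) • Y p) p := fun p => by
    rw [fderiv_smul_comp hN hΦ ha hh, spatialDiv_smul_comp hN hΦ hY hh]
    have h3 : a p * fderiv ℝ Φ p (1, 0) + fderiv ℝ Φ p (0, Y p) = 0 := by
      by_cases hp : p ∈ N
      · exact hbal p hp
      · rw [image_eq_zero_of_notMem_tsupport fun h => hp (ha.tsupport_subset h),
          image_eq_zero_of_notMem_tsupport fun h => hp (hY.tsupport_subset h), zero_mul, zero_add]
        exact map_zero _
    simp only [smul_eq_mul]
    linear_combination (deriv h (Φ p)) * h3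
  have hi1 : Integrable fun x =>
      (fderiv ℝ a (t, x) (1, 0) + spatialDiv Y (t, x)) * h (Φ (t, x)) :=
    integrable_weighted hN hΦ ((ha.fderiv_apply (1, 0)).add hY.spatialDiv) hh.continuous t
  have hi2 : Integrable fun x => spatialDiv (fun p => h (Φ p) • Y p) (t, x) := by
    have h3 : Integrable fun x => fderiv ℝ (fun p => h (Φ p) • a p) (t, x) (1, 0) :=
      integrable_slice ((hG.continuous_fderiv (by simp)).clm_apply continuous_const)
        (hGc.fderiv_apply (𝕜 := ℝ) _) t
    refine (hi1.sub h3).congr (ae_of_all _ fun x => ?_)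
    simp only [Pi.sub_apply, hpt, sub_sub_cancel]
  simp only [hpt] at h1
  rw [integral_sub hi1 hi2, h2, sub_zero] at h1
  simpa only [smul_eq_mul, mul_comm] using h1

/-- The weights `h(Φ)` with a probability density `h` have bounded integrals against an admissible
function, whatever their concentration: if `w` is a spatial field with `w · ∇Φ = 1` and `H' = h`,
then `a h(Φ) = a w · ∇(H(Φ))`, and an integration by parts leaves the bounded factor `H(Φ)`. -/
lemma exists_abs_weighted_le (hN : IsOpen N) (hΦ : ContDiffOn ℝ ∞ Φ N) {w : ℝ × E3 → E3}
    (hw : ContDiffOn ℝ ∞ w N) (hw1 : ∀ p ∈ N, fderiv ℝ Φ p (0, w p) = 1) {a : ℝ × E3 → ℝ}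
    (ha : Admissible N a) :
    ∃ C, 0 ≤ C ∧ ∀ h : ℝ → ℝ, Continuous h → (∀ r, 0 ≤ h r) → Integrable h → ∫ r, h r = 1 →
      ∀ t, |∫ x, a (t, x) * h (Φ (t, x))| ≤ C := by
  have hY : Admissible N fun p => a p • w p := ha.smul hN hw
  obtain ⟨C, hC0, hC⟩ := exists_integral_slice_le hY.spatialDiv.contDiff.continuous
    hY.spatialDiv.hasCompactSupport
  refine ⟨C, hC0, fun h hh h0 hi h1 t => ?_⟩
  set H : ℝ → ℝ := fun r => ∫ s in (0 : ℝ)..r, h s with hHdef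
  have hHd : ∀ r, HasDerivAt H (h r) r := fun r =>
    intervalIntegral.integral_hasDerivAt_right (hh.intervalIntegrable _ _)
      hh.aestronglyMeasurable.stronglyMeasurableAtFilter hh.continuousAt
  have hH' : deriv H = h := funext fun r => (hHd r).deriv
  have hHc : ContDiff ℝ 1 H := contDiff_one_iff_deriv.2
    ⟨fun r => (hHd r).differentiableAt, by rwa [hH']⟩
  have hHb : ∀ r, |H r| ≤ 1 := fun r => by
    refine (intervalIntegral.norm_integral_le_integral_norm_uIoc (f := h)).trans ?_
    rw [← h1]
    refine (setIntegral_le_integral hi.norm (ae_of_all _ fun s => norm_nonneg _)).trans_eq ?_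
    exact integral_congr_ae (ae_of_all _ fun s => Real.norm_of_nonneg (h0 s))
  have hZ := contDiff_smul_comp hN hΦ hY hHc
  have hZc : HasCompactSupport fun p => H (Φ p) • a p • w p :=
    hasCompactSupport_smul_comp hY.hasCompactSupport _
  have h2 := integral_spatialDiv hZ hZc t
  have hpt : ∀ p, spatialDiv (fun p => H (Φ p) • a p • w p) p =
      spatialDiv (fun p => a p • w p) p * H (Φ p) + a p * h (Φ p) := fun p => by
    rw [spatialDiv_smul_comp hN hΦ hY hHc, hH']
    have h3 : fderiv ℝ Φ p (0, a p • w p) = a p := by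
      by_cases hp : p ∈ N
      · have : ((0 : ℝ), a p • w p) = a p • ((0 : ℝ), w p) := by simp
        rw [this, map_smul, hw1 p hp]; simp
      · rw [image_eq_zero_of_notMem_tsupport fun h => hp (ha.tsupport_subset h), zero_smul]
        exact map_zero _
    rw [h3]; ring
  simp only [hpt] at h2
  have hiH := integrable_weighted hN hΦ hY.spatialDiv hHc.continuous t
  rw [integral_add hiH (integrable_weighted hN hΦ ha hh t)] at h2
  rw [eq_neg_of_add_eq_zero_right h2, abs_neg]
  refine (abs_integral_le_integral_abs).trans (le_trans (integral_mono hiH.abs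
    (integrable_slice hY.spatialDiv.contDiff.continuous
      hY.spatialDiv.hasCompactSupport t).abs fun x => ?_) (hC t))
  simp only [abs_mul]
  exact mul_le_of_le_one_right (abs_nonneg _) (hHb _)

end Transport

/-! ### Taylor expansion in time, uniform in the weight -/

/-- A continuous probability density with compact support is a uniform limit of continuously
differentiable ones. -/
lemma exists_contDiff_density_approx {h : ℝ → ℝ} (hh : Continuous h) (hhc : HasCompactSupport h)
    (h0 : ∀ r, 0 ≤ h r) (h1 : ∫ r, h r = 1) {η : ℝ} (hη : 0 < η) :
    ∃ k : ℝ → ℝ, ContDiff ℝ 1 k ∧ (∀ r, 0 ≤ k r) ∧ Integrable k ∧ ∫ r, k r = 1 ∧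
      ∀ r, |k r - h r| ≤ η := by
  obtain ⟨δ, hδ, hu⟩ := Metric.uniformContinuous_iff.1
    (hhc.uniformContinuous_of_continuous hh) η hη
  let b : ContDiffBump (0 : ℝ) := ⟨δ / 2, δ, by positivity, by linarith⟩
  have hi : Integrable h := hh.integrable_of_hasCompactSupport hhc
  refine ⟨b.normed volume ⋆[ContinuousLinearMap.lsmul ℝ ℝ] h, ?_, fun r => ?_, ?_, ?_, fun r => ?_⟩
  · exact b.hasCompactSupport_normed.contDiff_convolution_left (n := 1) _ b.contDiff_normed
      hi.locallyIntegrable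
  · exact integral_nonneg fun s => mul_nonneg (b.nonneg_normed s) (h0 _)
  · exact (b.integrable_normed).integrable_convolution _ hi
  · have := integral_convolution (ContinuousLinearMap.lsmul ℝ ℝ) (b.integrable_normed (μ := volume))
      hi
    rw [this, b.integral_normed, h1]
    simp
  · have := b.dist_normed_convolution_le (μ := volume) (x₀ := r) hh.aestronglyMeasurable
      (ε := η) fun x hx => (hu (Metric.mem_ball.1 hx)).le
    rwa [Real.dist_eq] at this

section Transport

variable {N : Set (ℝ × E3)} {Φ : ℝ × E3 → ℝ}

/-- Weighted integrals depend continuously, uniformly in time, on the weight in the sup norm. -/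
lemma abs_weighted_sub_le (hN : IsOpen N) (hΦ : ContDiffOn ℝ ∞ Φ N) {a : ℝ × E3 → ℝ}
    (ha : Admissible N a) {C : ℝ} (hC : ∀ t, ∫ x, |a (t, x)| ≤ C) {h k : ℝ → ℝ}
    (hh : Continuous h) (hk : Continuous k) {η : ℝ} (hη : 0 ≤ η) (hkh : ∀ r, |k r - h r| ≤ η)
    (t : ℝ) :
    |(∫ x, a (t, x) * k (Φ (t, x))) - ∫ x, a (t, x) * h (Φ (t, x))| ≤ C * η := by
  rw [← integral_sub (integrable_weighted hN hΦ ha hk t) (integrable_weighted hN hΦ ha hh t)]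
  have hi := (integrable_slice ha.contDiff.continuous ha.hasCompactSupport t).abs
  calc _ ≤ ∫ x, |a (t, x) * k (Φ (t, x)) - a (t, x) * h (Φ (t, x))| := abs_integral_le_integral_abs
    _ ≤ ∫ x, |a (t, x)| * η := by
        refine integral_mono ((integrable_weighted hN hΦ ha hk t).sub
          (integrable_weighted hN hΦ ha hh t)).abs (hi.mul_const _) fun x => ?_
        simp only [← mul_sub, abs_mul]
        exact mul_le_mul_of_nonneg_left (hkh _) (abs_nonneg _)
    _ = (∫ x, |a (t, x)|) * η := integral_mul_const _ _
    _ ≤ C * η := by gcongr; exact hC t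

/-- The first-order Taylor expansion in time of a weighted integral has a quadratic error whose
constant does not depend on the density `h`. For smooth `h` the second derivative is again a
weighted integral of an admissible function, hence bounded; the general case follows by
approximation. -/
lemma exists_weighted_taylor (hN : IsOpen N) (hΦ : ContDiffOn ℝ ∞ Φ N) {w u : ℝ × E3 → E3}
    (hw : ContDiffOn ℝ ∞ w N) (hw1 : ∀ p ∈ N, fderiv ℝ Φ p (0, w p) = 1)
    (hu : ContDiffOn ℝ ∞ u N) (hu0 : ∀ p ∈ N, fderiv ℝ Φ p (1, 0) + fderiv ℝ Φ p (0, u p) = 0)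
    {a : ℝ × E3 → ℝ} (ha : Admissible N a) {Y : ℝ × E3 → E3} (hY : Admissible N Y)
    (hbal : ∀ p ∈ N, a p * fderiv ℝ Φ p (1, 0) + fderiv ℝ Φ p (0, Y p) = 0) :
    ∃ C, 0 ≤ C ∧ ∀ h : ℝ → ℝ, Continuous h → HasCompactSupport h → (∀ r, 0 ≤ h r) →
      ∫ r, h r = 1 → ∀ s t,
        |(∫ x, a (s, x) * h (Φ (s, x))) - (∫ x, a (t, x) * h (Φ (t, x))) -
          (s - t) * ∫ x, (fderiv ℝ a (t, x) (1, 0) + spatialDiv Y (t, x)) * h (Φ (t, x))| ≤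
        C * (s - t) ^ 2 := by
  have hr : Admissible N fun p => fderiv ℝ a p (1, 0) + spatialDiv Y p :=
    (ha.fderiv_apply (1, 0)).add hY.spatialDiv
  set r : ℝ × E3 → ℝ := fun p => fderiv ℝ a p (1, 0) + spatialDiv Y p with hrdef
  have hru : Admissible N fun p => r p • u p := hr.smul hN hu
  have hrbal : ∀ p ∈ N, r p * fderiv ℝ Φ p (1, 0) + fderiv ℝ Φ p (0, r p • u p) = 0 := by
    intro p hp
    have : ((0 : ℝ), r p • u p) = r p • ((0 : ℝ), u p) := by simp
    rw [this, map_smul, smul_eq_mul, ← mul_add, hu0 p hp, mul_zero]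
  have hr' : Admissible N fun p => fderiv ℝ r p (1, 0) + spatialDiv (fun p => r p • u p) p :=
    (hr.fderiv_apply (1, 0)).add hru.spatialDiv
  obtain ⟨C, hC0, hC⟩ := exists_abs_weighted_le hN hΦ hw hw1 hr'
  obtain ⟨Ca, hCa0, hCa⟩ := exists_integral_slice_le ha.contDiff.continuous ha.hasCompactSupport
  obtain ⟨Cr, hCr0, hCr⟩ := exists_integral_slice_le hr.contDiff.continuous hr.hasCompactSupport
  -- the estimate for continuously differentiable densities
  have hsmooth : ∀ k : ℝ → ℝ, ContDiff ℝ 1 k → (∀ r, 0 ≤ k r) → Integrable k → ∫ r, k r = 1 →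
      ∀ s t, |(∫ x, a (s, x) * k (Φ (s, x))) - (∫ x, a (t, x) * k (Φ (t, x))) -
          (s - t) * ∫ x, r (t, x) * k (Φ (t, x))| ≤ C * (s - t) ^ 2 := by
    intro k hk hk0 hki hk1 s t
    have hd1 : ∀ τ, HasDerivAt (fun s => ∫ x, a (s, x) * k (Φ (s, x)))
        (∫ x, r (τ, x) * k (Φ (τ, x))) τ := fun τ => hasDerivAt_weighted hN hΦ ha hY hbal hk τ
    have hd2 := fun τ => hasDerivAt_weighted hN hΦ hr hru hrbal hk τ
    have hLip : ∀ τ, |(∫ x, r (τ, x) * k (Φ (τ, x))) - ∫ x, r (t, x) * k (Φ (t, x))| ≤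
        C * |τ - t| := fun τ =>
      convex_univ.norm_image_sub_le_of_norm_hasDerivWithin_le
        (fun x _ => (hd2 x).hasDerivWithinAt) (fun x _ => hC k hk.continuous hk0 hki hk1 x)
        (mem_univ t) (mem_univ τ)
    have h3 := (convex_uIcc t s).norm_image_sub_le_of_norm_hasDerivWithin_le
      (f := fun τ => (∫ x, a (τ, x) * k (Φ (τ, x))) - τ * ∫ x, r (t, x) * k (Φ (t, x)))
      (f' := fun τ => (∫ x, r (τ, x) * k (Φ (τ, x))) - 1 * ∫ x, r (t, x) * k (Φ (t, x)))
      (C := C * |s - t|)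
      (fun τ _ => ((hd1 τ).sub ((hasDerivAt_id τ).mul_const _)).hasDerivWithinAt)
      (fun τ hτ => by
        rw [one_mul]
        exact (hLip τ).trans (mul_le_mul_of_nonneg_left (abs_sub_left_of_mem_uIcc hτ) hC0))
      left_mem_uIcc right_mem_uIcc
    rw [Real.norm_eq_abs, Real.norm_eq_abs, mul_assoc, ← sq, sq_abs] at h3
    convert h3 using 2
    ring
  refine ⟨C, hC0, fun h hh hhc h0 h1 s t => ?_⟩
  -- `C` does not depend on the density, so the estimate survives uniform approximation
  refine le_of_forall_pos_le_add fun δ hδ => ?_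
  have hden : 0 < Ca + Ca + |s - t| * Cr + 1 := by positivity
  set η := δ / (Ca + Ca + |s - t| * Cr + 1) with hηdef
  have hη : 0 < η := by positivity
  obtain ⟨k, hk, hk0, hki, hk1, hkh⟩ := exists_contDiff_density_approx hh hhc h0 h1 hη
  have e1 := hsmooth k hk hk0 hki hk1 s t
  have e2 := abs_weighted_sub_le hN hΦ ha hCa hh hk.continuous hη.le hkh s
  have e3 := abs_weighted_sub_le hN hΦ ha hCa hh hk.continuous hη.le hkh t
  have e4 := abs_weighted_sub_le hN hΦ hr hCr hh hk.continuous hη.le hkh t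
  have e5 : (Ca + Ca + |s - t| * Cr) * η ≤ δ := by
    rw [hηdef, mul_div_assoc', div_le_iff₀ hden]
    nlinarith
  set As := ∫ x, a (s, x) * h (Φ (s, x))
  set At := ∫ x, a (t, x) * h (Φ (t, x))
  set Rt := ∫ x, r (t, x) * h (Φ (t, x))
  set As' := ∫ x, a (s, x) * k (Φ (s, x))
  set At' := ∫ x, a (t, x) * k (Φ (t, x))
  set Rt' := ∫ x, r (t, x) * k (Φ (t, x))
  have e6 : As - At - (s - t) * Rt =
      (As' - At' - (s - t) * Rt') - (As' - As) + (At' - At) + (s - t) * (Rt' - Rt) := by ring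
  rw [e6]
  have e7 : |(s - t) * (Rt' - Rt)| ≤ |s - t| * (Cr * η) := by
    rw [abs_mul]; gcongr
  have e8 := abs_add_le ((As' - At' - (s - t) * Rt') - (As' - As) + (At' - At))
    ((s - t) * (Rt' - Rt))
  have e9 := abs_add_le ((As' - At' - (s - t) * Rt') - (As' - As)) (At' - At)
  have e10 := abs_sub (As' - At' - (s - t) * Rt') (As' - As)
  linarith

/-- A first-order expansion with a quadratic error bound yields the derivative. The bound, unlike
differentiability itself, survives pointwise limits. -/
lemma hasDerivAt_of_quadratic {F : ℝ → ℝ} {F' C t : ℝ}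
    (h : ∀ᶠ s in 𝓝 t, |F s - F t - (s - t) * F'| ≤ C * (s - t) ^ 2) : HasDerivAt F F' t := by
  rw [hasDerivAt_iff_isLittleO]
  have h1 : (fun s => F s - F t - (s - t) • F') =O[𝓝 t] fun s => (s - t) ^ 2 :=
    Asymptotics.IsBigO.of_bound C (by
      filter_upwards [h] with s hs
      simpa using hs)
  refine h1.trans_isLittleO ?_
  have h2 : Tendsto (fun s : ℝ => s - t) (𝓝 t) (𝓝 0) := by
    have : Tendsto (fun s : ℝ => s - t) (𝓝 t) (𝓝 (t - t)) := Continuous.tendsto (by fun_prop) t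
    simpa using this
  exact (Asymptotics.isLittleO_pow_id one_lt_two).comp_tendsto h2

end Transport

/-! ### Divergence and gradient -/

lemma HasFDerivAt.divergence_eq {v : E3 → E3} {L : E3 →L[ℝ] E3} {x : E3} (h : HasFDerivAt v L x) :
    divergence v x = ∑ i : Fin 3, L (EuclideanSpace.single i 1) i := by
  rw [divergence, h.fderiv]

lemma divergence_add {v w : E3 → E3} {x : E3} (hv : DifferentiableAt ℝ v x)
    (hw : DifferentiableAt ℝ w x) :
    divergence (fun y => v y + w y) x = divergence v x + divergence w x := by
  rw [HasFDerivAt.divergence_eq (hv.hasFDerivAt.fun_add hw.hasFDerivAt), divergence, divergence,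
    ← Finset.sum_add_distrib]
  rfl

lemma divergence_smul {s : E3 → ℝ} {v : E3 → E3} {x : E3} (hs : DifferentiableAt ℝ s x)
    (hv : DifferentiableAt ℝ v x) :
    divergence (fun y => s y • v y) x = s x * divergence v x + fderiv ℝ s x (v x) := by
  rw [HasFDerivAt.divergence_eq (hs.hasFDerivAt.fun_smul hv.hasFDerivAt), divergence,
    clm_apply_eq_sum (fderiv ℝ s x), Finset.mul_sum, ← Finset.sum_add_distrib]
  refine Finset.sum_congr rfl fun i _ => ?_
  simp
  ring

lemma inner_gradient_left {f : E3 → ℝ} (x w : E3) : ⟪∇ f x, w⟫ = fderiv ℝ f x w := by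
  simp [gradient]

lemma contDiffOn_gradient {f : E3 → ℝ} {s : Set E3} (hs : IsOpen s) (hf : ContDiffOn ℝ ∞ f s) :
    ContDiffOn ℝ ∞ (∇ f) s :=
  (InnerProductSpace.toDual ℝ E3).symm.contDiff.comp_contDiffOn
    (hf.fderiv_of_isOpen hs (m := ∞) (by simp))

/-! ### The one-homogeneous extension -/

/-- The positively one-homogeneous extension `p ↦ |p| f(p/|p|)` of `f` from the unit sphere. -/
noncomputable def homExt (f : E3 → ℝ) (p : E3) : ℝ := ‖p‖ * f (‖p‖⁻¹ • p)

/-- The gradient `f(m) m + (I - m ⊗ m) ∇f(m)`, `m = p/|p|`, of the one-homogeneous extension. -/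
noncomputable def homExtGrad (f : E3 → ℝ) (p : E3) : E3 :=
  f (‖p‖⁻¹ • p) • ‖p‖⁻¹ • p + tangentialPart (‖p‖⁻¹ • p) (∇ f (‖p‖⁻¹ • p))

lemma norm_normalize {p : E3} (hp : p ≠ 0) : ‖‖p‖⁻¹ • p‖ = 1 := by
  rw [norm_smul, norm_inv, norm_norm, inv_mul_cancel₀ (norm_ne_zero_iff.2 hp)]

lemma normalize_ne_zero {p : E3} (hp : p ≠ 0) : ‖p‖⁻¹ • p ≠ 0 :=
  smul_ne_zero (inv_ne_zero (norm_ne_zero_iff.2 hp)) hp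

lemma contDiffOn_norm : ContDiffOn ℝ ∞ (fun p : E3 => ‖p‖) {0}ᶜ := fun _ hp =>
  (contDiffAt_norm ℝ hp).contDiffWithinAt

lemma contDiffOn_normalize : ContDiffOn ℝ ∞ (fun p : E3 => ‖p‖⁻¹ • p) {0}ᶜ :=
  (contDiffOn_norm.inv fun _ hp => norm_ne_zero_iff.2 hp).smul contDiffOn_id

lemma contDiffOn_comp_normalize {F : Type*} [NormedAddCommGroup F] [NormedSpace ℝ F] {f : E3 → F}
    (hf : ContDiffOn ℝ ∞ f {0}ᶜ) : ContDiffOn ℝ ∞ (fun p : E3 => f (‖p‖⁻¹ • p)) {0}ᶜ :=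
  hf.comp contDiffOn_normalize fun _ hp => normalize_ne_zero hp

lemma contDiffOn_homExt {f : E3 → ℝ} (hf : ContDiffOn ℝ ∞ f {0}ᶜ) :
    ContDiffOn ℝ ∞ (homExt f) {0}ᶜ :=
  contDiffOn_norm.mul (contDiffOn_comp_normalize hf)

lemma contDiffOn_homExtGrad {f : E3 → ℝ} (hf : ContDiffOn ℝ ∞ f {0}ᶜ) :
    ContDiffOn ℝ ∞ (homExtGrad f) {0}ᶜ := by
  have h1 := contDiffOn_comp_normalize hf
  have h2 := contDiffOn_comp_normalize (contDiffOn_gradient isOpen_compl_singleton hf)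
  exact (h1.smul contDiffOn_normalize).add
    (h2.sub ((h2.inner ℝ contDiffOn_normalize).smul contDiffOn_normalize))

lemma inner_tangentialPart {ν : E3} (hν : ‖ν‖ = 1) (v : E3) : ⟪tangentialPart ν v, ν⟫ = 0 := by
  rw [tangentialPart, inner_sub_left, inner_smul_left, real_inner_self_eq_norm_sq, hν]
  simp

/-- Euler's identity for the one-homogeneous extension. -/
lemma inner_homExtGrad {f : E3 → ℝ} {p : E3} (hp : p ≠ 0) : ⟪homExtGrad f p, p⟫ = homExt f p := by
  have h1 := norm_normalize hp
  have h2 : p = ‖p‖ • ‖p‖⁻¹ • p := by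
    rw [smul_smul, mul_inv_cancel₀ (norm_ne_zero_iff.2 hp), one_smul]
  have h3 : ⟪homExtGrad f p, ‖p‖⁻¹ • p⟫ = f (‖p‖⁻¹ • p) := by
    rw [homExtGrad, inner_add_left, inner_tangentialPart h1, inner_smul_left,
      real_inner_self_eq_norm_sq, h1]
    simp
  calc ⟪homExtGrad f p, p⟫ = ⟪homExtGrad f p, ‖p‖ • ‖p‖⁻¹ • p⟫ := by rw [← h2]
    _ = homExt f p := by rw [inner_smul_right, h3, homExt]

lemma hasFDerivAt_homExt {f : E3 → ℝ} (hf : ContDiffOn ℝ ∞ f {0}ᶜ) {p : E3} (hp : p ≠ 0) :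
    HasFDerivAt (homExt f) (innerSL ℝ (homExtGrad f p)) p := by
  have hp' : ‖p‖ ≠ 0 := norm_ne_zero_iff.2 hp
  set m : E3 := ‖p‖⁻¹ • p with hm
  have hnhds : ({0}ᶜ : Set E3) ∈ 𝓝 p := isOpen_compl_singleton.mem_nhds hp
  have hN : HasFDerivAt (fun q : E3 => ‖q‖) (innerSL ℝ m) p := by
    have h1 := ((contDiffOn_norm.contDiffAt hnhds).differentiableAt (by simp)).hasFDerivAt
    have h2 := (hasStrictFDerivAt_norm_sq p).hasFDerivAt.unique (h1.pow 2)
    refine h1.congr_fderiv ?_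
    ext w
    have h3 := congrArg (fun L : E3 →L[ℝ] ℝ => L w) h2
    simp at h3
    rw [innerSL_apply_apply, hm, inner_smul_left]
    simp only [conj_trivial]
    field_simp
    linarith
  have hmd := ((hasDerivAt_inv hp').comp_hasFDerivAt p hN).smul (hasFDerivAt_id p)
  have hfm : HasFDerivAt f (fderiv ℝ f m) m :=
    ((hf.contDiffAt (isOpen_compl_singleton.mem_nhds (normalize_ne_zero hp))).differentiableAt
      (by simp)).hasFDerivAt
  have h4 := hN.mul (hfm.comp p hmd)
  refine h4.congr_fderiv ?_
  ext w
  have hfd : ∀ v, fderiv ℝ f m v = ⟪∇ f m, v⟫ := fun v => (inner_gradient_left m v).symm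
  simp only [homExtGrad, tangentialPart, ← hm, hfd, inner_add_left, inner_sub_left,
    real_inner_smul_left, inner_add_right, real_inner_smul_right, innerSL_apply_apply,
    _root_.add_apply, _root_.smul_apply, ContinuousLinearMap.comp_apply,
    ContinuousLinearMap.smulRight_apply, ContinuousLinearMap.id_apply, smul_eq_mul,
    Function.comp_apply, Pi.smul_apply', id]
  have h5 : ⟪∇ f m, p⟫ = ‖p‖ * ⟪∇ f m, m⟫ := by
    rw [hm, inner_smul_right]; field_simp
  rw [h5]
  field_simp
  ring

/-! ### The tangential and the full divergence -/

section Pointwise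

variable {f φ : E3 → ℝ} {x : E3}

lemma eventually_gradient_ne_zero (hφ : ContDiff ℝ ∞ φ) (hx : ∇ φ x ≠ 0) :
    ∀ᶠ y in 𝓝 x, ∇ φ y ≠ 0 :=
  (continuous_gradient (hφ.of_le (by simp))).continuousAt.eventually_ne hx

lemma contDiffAt_comp_unitNormal {F : Type*} [NormedAddCommGroup F] [NormedSpace ℝ F] {g : E3 → F}
    (hφ : ContDiff ℝ ∞ φ) (hx : ∇ φ x ≠ 0) (hg : ContDiffOn ℝ ∞ g {0}ᶜ) :
    ContDiffAt ℝ ∞ (fun y => g (unitNormal φ y)) x := by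
  have h1 : ContDiffAt ℝ ∞ (∇ φ) x :=
    (contDiffOn_gradient isOpen_univ hφ.contDiffOn).contDiffAt univ_mem
  exact ((contDiffOn_comp_normalize hg).contDiffAt
    (isOpen_compl_singleton.mem_nhds hx)).comp x h1

lemma differentiableAt_unitNormal (hφ : ContDiff ℝ ∞ φ) (hx : ∇ φ x ≠ 0) :
    DifferentiableAt ℝ (unitNormal φ) x :=
  (contDiffAt_comp_unitNormal hφ hx contDiffOn_id).differentiableAt (by simp)

lemma norm_unitNormal (hx : ∇ φ x ≠ 0) : ‖unitNormal φ x‖ = 1 := norm_normalize hx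

lemma unitNormal_ne_zero (hx : ∇ φ x ≠ 0) : unitNormal φ x ≠ 0 := normalize_ne_zero hx

lemma inner_fderiv_add_eq_zero {v w : E3 → E3} (hv : DifferentiableAt ℝ v x)
    (hw : DifferentiableAt ℝ w x) {c : ℝ} (h : ∀ᶠ y in 𝓝 x, ⟪v y, w y⟫ = c) (z : E3) :
    ⟪v x, fderiv ℝ w x z⟫ + ⟪fderiv ℝ v x z, w x⟫ = 0 := by
  rw [← fderiv_inner_apply ℝ hv hw, EventuallyEq.fderiv_eq (f := fun _ => c) h]
  simp

lemma inner_fderiv_unitNormal (hφ : ContDiff ℝ ∞ φ) (hx : ∇ φ x ≠ 0) (z : E3) :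
    ⟪fderiv ℝ (unitNormal φ) x z, unitNormal φ x⟫ = 0 := by
  have hn := differentiableAt_unitNormal hφ hx
  have h := inner_fderiv_add_eq_zero hn hn (c := 1) (by
    filter_upwards [eventually_gradient_ne_zero hφ hx] with y hy
    rw [real_inner_self_eq_norm_sq, norm_unitNormal hy, one_pow]) z
  rw [real_inner_comm] at h
  linarith

lemma differentiableAt_comp_unitNormal (hφ : ContDiff ℝ ∞ φ) (hf : ContDiffOn ℝ ∞ f {0}ᶜ)
    (hx : ∇ φ x ≠ 0) : DifferentiableAt ℝ (fun y => f (unitNormal φ y)) x :=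
  (contDiffAt_comp_unitNormal hφ hx hf).differentiableAt (by simp)

lemma differentiableAt_gradAtNormal (hφ : ContDiff ℝ ∞ φ) (hf : ContDiffOn ℝ ∞ f {0}ᶜ)
    (hx : ∇ φ x ≠ 0) : DifferentiableAt ℝ (gradAtNormal f φ) x :=
  (contDiffAt_comp_unitNormal hφ hx
    (contDiffOn_gradient isOpen_compl_singleton hf)).differentiableAt (by simp)

lemma differentiableAt_tangentialGradAtNormal (hφ : ContDiff ℝ ∞ φ) (hf : ContDiffOn ℝ ∞ f {0}ᶜ)
    (hx : ∇ φ x ≠ 0) : DifferentiableAt ℝ (tangentialGradAtNormal f φ) x := by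
  have h1 := differentiableAt_gradAtNormal hφ hf hx
  have h2 := differentiableAt_unitNormal hφ hx
  exact h1.sub ((h1.inner ℝ h2).smul h2)

lemma fderiv_comp_unitNormal (hφ : ContDiff ℝ ∞ φ) (hf : ContDiffOn ℝ ∞ f {0}ᶜ)
    (hx : ∇ φ x ≠ 0) (z : E3) : fderiv ℝ (fun y => f (unitNormal φ y)) x z =
      ⟪tangentialGradAtNormal f φ x, fderiv ℝ (unitNormal φ) x z⟫ := by
  have h1 : HasFDerivAt f (fderiv ℝ f (unitNormal φ x)) (unitNormal φ x) :=
    ((hf.contDiffAt (isOpen_compl_singleton.mem_nhds (unitNormal_ne_zero hx))).differentiableAt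
      (by simp)).hasFDerivAt
  have h2 := h1.comp x (differentiableAt_unitNormal hφ hx).hasFDerivAt
  have h3 : fderiv ℝ (fun y => f (unitNormal φ y)) x = _ := h2.fderiv
  rw [h3, tangentialGradAtNormal, tangentialPart, inner_sub_left, inner_smul_left,
    real_inner_comm (fderiv ℝ (unitNormal φ) x z) (unitNormal φ x),
    inner_fderiv_unitNormal hφ hx, mul_zero, sub_zero, gradAtNormal, inner_gradient_left]
  rfl

lemma meanCurvature_eq_divergence (hφ : ContDiff ℝ ∞ φ) (hx : ∇ φ x ≠ 0) :
    meanCurvature φ x = divergence (unitNormal φ) x := by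
  rw [meanCurvature, tangentialDiv, inner_fderiv_unitNormal hφ hx, sub_zero]

/-- The normal derivative of `f(n)` equals `-(∇[∇_τ f(n)] n) · n`, because `∇_τ f(n)` stays
orthogonal to `n`; so the full and the tangential divergence give the same density. -/
lemma volumicDensity_eq_surfaceDensity (hφ : ContDiff ℝ ∞ φ) (hf : ContDiffOn ℝ ∞ f {0}ᶜ)
    (hx : ∇ φ x ≠ 0) : volumicDensity f φ x = surfaceDensity f φ x := by
  have hn := differentiableAt_unitNormal hφ hx
  have hfn := differentiableAt_comp_unitNormal hφ hf hx
  have hT := differentiableAt_tangentialGradAtNormal hφ hf hx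
  have h1 := inner_fderiv_add_eq_zero hT hn (c := 0) (by
    filter_upwards [eventually_gradient_ne_zero hφ hx] with y hy
    exact inner_tangentialPart (norm_unitNormal hy) _) (unitNormal φ x)
  rw [volumicDensity, divergence_add (hfn.fun_smul hn) hT, divergence_smul hfn hn,
    fderiv_comp_unitNormal hφ hf hx, surfaceDensity, meanCurvature_eq_divergence hφ hx,
    tangentialDiv]
  linarith

/-- Euler's identity `∇f(z) · z = f(z)`. -/
lemma inner_gradient_self_of_homogeneous (hf : ContDiffOn ℝ ∞ f {0}ᶜ)
    (hhom : ∀ s : ℝ, 0 < s → ∀ x : E3, x ≠ 0 → f (s • x) = s * f x) {z : E3} (hz : z ≠ 0) :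
    ⟪∇ f z, z⟫ = f z := by
  have h1 : HasFDerivAt f (fderiv ℝ f ((1 : ℝ) • z)) ((1 : ℝ) • z) := by
    rw [one_smul]
    exact ((hf.contDiffAt (isOpen_compl_singleton.mem_nhds hz)).differentiableAt
      (by simp)).hasFDerivAt
  have h2 : HasDerivAt (fun s : ℝ => s • z) ((1 : ℝ) • z) 1 := (hasDerivAt_id 1).smul_const z
  have h3 := h1.comp_hasDerivAt 1 h2
  have h4 : HasDerivAt (fun s : ℝ => s * f z) (1 * f z) 1 := (hasDerivAt_id 1).mul_const _
  have h5 := h3.unique (h4.congr_of_eventuallyEq (by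
    filter_upwards [lt_mem_nhds one_pos] with s hs using hhom s hs z hz))
  rw [inner_gradient_left]
  simpa using h5

lemma anisotropicMeanCurvature_eq_surfaceDensity (hφ : ContDiff ℝ ∞ φ)
    (hf : ContDiffOn ℝ ∞ f {0}ᶜ)
    (hhom : ∀ s : ℝ, 0 < s → ∀ x : E3, x ≠ 0 → f (s • x) = s * f x) (hx : ∇ φ x ≠ 0) :
    anisotropicMeanCurvature f φ x = surfaceDensity f φ x := by
  have hn := differentiableAt_unitNormal hφ hx
  have hfn := differentiableAt_comp_unitNormal hφ hf hx
  have hT := differentiableAt_tangentialGradAtNormal hφ hf hx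
  have heq : gradAtNormal f φ =ᶠ[𝓝 x] fun y =>
      f (unitNormal φ y) • unitNormal φ y + tangentialGradAtNormal f φ y := by
    filter_upwards [eventually_gradient_ne_zero hφ hx] with y hy
    rw [tangentialGradAtNormal, tangentialPart, gradAtNormal,
      inner_gradient_self_of_homogeneous hf hhom (unitNormal_ne_zero hy)]
    abel
  have hdiv : divergence (gradAtNormal f φ) x = volumicDensity f φ x := by
    rw [divergence, heq.fderiv_eq, volumicDensity, divergence]
  have hder : fderiv ℝ (gradAtNormal f φ) x (unitNormal φ x) =
      f (unitNormal φ x) • fderiv ℝ (unitNormal φ) x (unitNormal φ x) +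
      fderiv ℝ (fun y => f (unitNormal φ y)) x (unitNormal φ x) • unitNormal φ x +
      fderiv ℝ (tangentialGradAtNormal f φ) x (unitNormal φ x) := by
    rw [heq.fderiv_eq, ((hfn.hasFDerivAt.fun_smul hn.hasFDerivAt).fun_add hT.hasFDerivAt).fderiv]
    simp
  have h1 := inner_fderiv_add_eq_zero hT hn (c := 0) (by
    filter_upwards [eventually_gradient_ne_zero hφ hx] with y hy
    exact inner_tangentialPart (norm_unitNormal hy) _) (unitNormal φ x)
  rw [anisotropicMeanCurvature, tangentialDiv, hdiv, hder,
    volumicDensity_eq_surfaceDensity hφ hf hx, inner_add_left, inner_add_left, inner_smul_left,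
    inner_smul_left, inner_fderiv_unitNormal hφ hx, real_inner_self_eq_norm_sq,
    norm_unitNormal hx, fderiv_comp_unitNormal hφ hf hx]
  simp only [conj_trivial]
  linarith

end Pointwise

/-! ### Level set functions in space-time -/

section SpaceTime

variable {I : Set ℝ} {φ : ℝ → E3 → ℝ} {u : ℝ → E3 → E3} {Q : Set E3} {f : E3 → ℝ}

lemma prod_univ_mem_nhds (hI : IsOpen I) {p : ℝ × E3} (hp : p.1 ∈ I) :
    I ×ˢ (univ : Set E3) ∈ 𝓝 p :=
  (hI.prod isOpen_univ).mem_nhds ⟨hp, mem_univ _⟩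

lemma contDiff_slice {F : Type*} [NormedAddCommGroup F] [NormedSpace ℝ F] {φ : ℝ → E3 → F}
    (hφ : ContDiffOn ℝ ∞ (fun p : ℝ × E3 => φ p.1 p.2) (I ×ˢ univ)) {t : ℝ} (ht : t ∈ I) :
    ContDiff ℝ ∞ (φ t) := by
  have h : ContDiffOn ℝ ∞ (fun x : E3 => (fun p : ℝ × E3 => φ p.1 p.2) (t, x)) univ :=
    hφ.comp (contDiff_prodMk_right t).contDiffOn fun x _ => ⟨ht, mem_univ _⟩
  exact contDiffOn_univ.1 h

lemma inner_gradient_slice (hI : IsOpen I)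
    (hφ : ContDiffOn ℝ ∞ (fun p : ℝ × E3 => φ p.1 p.2) (I ×ˢ univ)) {p : ℝ × E3} (hp : p.1 ∈ I)
    (w : E3) :
    ⟪∇ (φ p.1) p.2, w⟫ = fderiv ℝ (fun p : ℝ × E3 => φ p.1 p.2) p (0, w) := by
  have hd : DifferentiableAt ℝ (fun p : ℝ × E3 => φ p.1 p.2) (p.1, p.2) :=
    (hφ.contDiffAt (prod_univ_mem_nhds hI hp)).differentiableAt (by simp)
  rw [inner_gradient_left]
  have h : fderiv ℝ (φ p.1) p.2 = _ := (hasFDerivAt_slice hd).fderiv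
  rw [h]
  simp

lemma contDiffOn_spatialGradient (hI : IsOpen I)
    (hφ : ContDiffOn ℝ ∞ (fun p : ℝ × E3 => φ p.1 p.2) (I ×ˢ univ)) :
    ContDiffOn ℝ ∞ (fun p : ℝ × E3 => ∇ (φ p.1) p.2) (I ×ˢ univ) := by
  have h1 : ContDiffOn ℝ ∞ (fun p : ℝ × E3 => (InnerProductSpace.toDual ℝ E3).symm
      ((fderiv ℝ (fun p : ℝ × E3 => φ p.1 p.2) p).comp (.inr ℝ ℝ E3))) (I ×ˢ univ) :=
    (InnerProductSpace.toDual ℝ E3).symm.contDiff.comp_contDiffOn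
      ((hφ.fderiv_of_isOpen (hI.prod isOpen_univ) (m := ∞) (by simp)).clm_comp contDiffOn_const)
  refine h1.congr fun p hp => ?_
  refine ext_inner_right ℝ fun w => ?_
  rw [inner_gradient_slice hI hφ hp.1, InnerProductSpace.toDual_symm_apply]
  simp

lemma deriv_slice (hI : IsOpen I)
    (hφ : ContDiffOn ℝ ∞ (fun p : ℝ × E3 => φ p.1 p.2) (I ×ˢ univ)) {p : ℝ × E3} (hp : p.1 ∈ I) :
    deriv (fun s => φ s p.2) p.1 = fderiv ℝ (fun p : ℝ × E3 => φ p.1 p.2) p (1, 0) := by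
  have hd : DifferentiableAt ℝ (fun p : ℝ × E3 => φ p.1 p.2) (p.1, p.2) :=
    (hφ.contDiffAt (prod_univ_mem_nhds hI hp)).differentiableAt (by simp)
  have h2 : HasDerivAt (fun r : ℝ => (r, p.2)) ((1 : ℝ), (0 : E3)) p.1 :=
    (hasDerivAt_id p.1).prodMk (hasDerivAt_const p.1 p.2)
  exact (hd.hasFDerivAt.comp_hasDerivAt p.1 h2).deriv

lemma fderiv_time_eq (hI : IsOpen I)
    (hφ : ContDiffOn ℝ ∞ (fun p : ℝ × E3 => φ p.1 p.2) (I ×ˢ univ))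
    (htransport : ∀ t ∈ I, ∀ x, deriv (fun s => φ s x) t + ⟪u t x, ∇ (φ t) x⟫ = 0)
    {p : ℝ × E3} (hp : p.1 ∈ I) :
    fderiv ℝ (fun p : ℝ × E3 => φ p.1 p.2) p (1, 0) = -⟪u p.1 p.2, ∇ (φ p.1) p.2⟫ := by
  rw [← deriv_slice hI hφ hp]
  linarith [htransport p.1 hp p.2]

/-- The transport equation, differentiated in space: `∂ₜ∇φ = -∇(u · ∇φ)`. -/
lemma inner_fderiv_spatialGradient_time (hI : IsOpen I)
    (hφ : ContDiffOn ℝ ∞ (fun p : ℝ × E3 => φ p.1 p.2) (I ×ˢ univ))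
    (htransport : ∀ t ∈ I, ∀ x, deriv (fun s => φ s x) t + ⟪u t x, ∇ (φ t) x⟫ = 0)
    {p : ℝ × E3} (hp : p.1 ∈ I) (w : E3) :
    ⟪w, fderiv ℝ (fun p : ℝ × E3 => ∇ (φ p.1) p.2) p (1, 0)⟫ =
      -fderiv ℝ (fun p : ℝ × E3 => ⟪u p.1 p.2, ∇ (φ p.1) p.2⟫) p (0, w) := by
  set Φ : ℝ × E3 → ℝ := fun p => φ p.1 p.2 with hΦ
  have hnear : ∀ᶠ q in 𝓝 p, q.1 ∈ I := by
    filter_upwards [prod_univ_mem_nhds hI hp] with q hq using hq.1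
  have hsm : ContDiffAt ℝ ∞ Φ p := hφ.contDiffAt (prod_univ_mem_nhds hI hp)
  have hΦ' : DifferentiableAt ℝ (fderiv ℝ Φ) p :=
    (hsm.fderiv_right (m := ∞) (by simp)).differentiableAt (by simp)
  have hsymm : IsSymmSndFDerivAt ℝ Φ p := hsm.isSymmSndFDerivAt (by
    rw [minSmoothness_of_isRCLikeNormedField]; exact WithTop.coe_le_coe.2 le_top)
  have hg : DifferentiableAt ℝ (fun p : ℝ × E3 => ∇ (φ p.1) p.2) p :=
    ((contDiffOn_spatialGradient hI hφ).contDiffAt (prod_univ_mem_nhds hI hp)).differentiableAt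
      (by simp)
  have h1 : (fun q : ℝ × E3 => ⟪w, ∇ (φ q.1) q.2⟫) =ᶠ[𝓝 p] fun q => fderiv ℝ Φ q (0, w) := by
    filter_upwards [hnear] with q hq
    rw [real_inner_comm, inner_gradient_slice hI hφ hq]
  have h2 : (fun q : ℝ × E3 => ⟪u q.1 q.2, ∇ (φ q.1) q.2⟫) =ᶠ[𝓝 p]
      fun q => -fderiv ℝ Φ q (1, 0) := by
    filter_upwards [hnear] with q hq
    rw [fderiv_time_eq hI hφ htransport hq, neg_neg]
  have h3 : fderiv ℝ (fun q : ℝ × E3 => ⟪w, ∇ (φ q.1) q.2⟫) p (1, 0) =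
      ⟪w, fderiv ℝ (fun p : ℝ × E3 => ∇ (φ p.1) p.2) p (1, 0)⟫ := by
    rw [fderiv_inner_apply ℝ (differentiableAt_const w) hg]
    simp
  have h4 : ∀ v, fderiv ℝ (fun q => fderiv ℝ Φ q v) p = (fderiv ℝ (fderiv ℝ Φ) p).flip v :=
    fun v => by
      rw [fderiv_clm_apply hΦ' (differentiableAt_const v)]
      simp
  rw [← h3, h1.fderiv_eq, h2.fderiv_eq, fderiv_fun_neg, h4, h4]
  simp only [ContinuousLinearMap.flip_apply, _root_.neg_apply, neg_neg]
  exact hsymm _ _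

/-- The space-time points over `I × Q` at which `∇φ ≠ 0`. -/
def regularSet (I : Set ℝ) (Q : Set E3) (φ : ℝ → E3 → ℝ) : Set (ℝ × E3) :=
  {p | p.1 ∈ I ∧ p.2 ∈ Q ∧ ∇ (φ p.1) p.2 ≠ 0}

lemma isOpen_regularSet (hI : IsOpen I) (hQ : IsOpen Q)
    (hφ : ContDiffOn ℝ ∞ (fun p : ℝ × E3 => φ p.1 p.2) (I ×ˢ univ)) :
    IsOpen (regularSet I Q φ) := by
  have h1 := ((contDiffOn_spatialGradient hI hφ).continuousOn.mono
    (prod_mono_right (subset_univ Q))).isOpen_inter_preimage (hI.prod hQ) isOpen_compl_singleton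
    (t := {(0 : E3)}ᶜ)
  have h2 : regularSet I Q φ = I ×ˢ Q ∩ (fun p => ∇ (φ p.1) p.2) ⁻¹' {0}ᶜ :=
    Set.ext fun p => ⟨fun h => ⟨⟨h.1, h.2.1⟩, h.2.2⟩, fun h => ⟨h.1.1, h.1.2, h.2⟩⟩
  rwa [h2]

lemma contDiffOn_comp_spatialGradient {F : Type*} [NormedAddCommGroup F] [NormedSpace ℝ F]
    (hI : IsOpen I) (hφ : ContDiffOn ℝ ∞ (fun p : ℝ × E3 => φ p.1 p.2) (I ×ˢ univ)) {g : E3 → F}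
    (hg : ContDiffOn ℝ ∞ g {0}ᶜ) :
    ContDiffOn ℝ ∞ (fun p : ℝ × E3 => g (∇ (φ p.1) p.2)) (regularSet I Q φ) :=
  hg.comp ((contDiffOn_spatialGradient hI hφ).mono fun _ hp => ⟨hp.1, mem_univ _⟩)
    fun _ hp => hp.2.2

/-- The volumic first variation: `∂ₜ F(∇φ) + div ((u · ∇φ) ∇F(∇φ)) = div (∇F(∇φ)) (u · ∇φ)` for the
one-homogeneous extension `F` of `f`. -/
lemma volumic_first_variation (hI : IsOpen I) (hQ : IsOpen Q)
    (hφ : ContDiffOn ℝ ∞ (fun p : ℝ × E3 => φ p.1 p.2) (I ×ˢ univ))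
    (hu : ContDiffOn ℝ ∞ (fun p : ℝ × E3 => u p.1 p.2) (I ×ˢ univ))
    (htransport : ∀ t ∈ I, ∀ x, deriv (fun s => φ s x) t + ⟪u t x, ∇ (φ t) x⟫ = 0)
    (hf : ContDiffOn ℝ ∞ f {0}ᶜ) {p : ℝ × E3} (hp : p ∈ regularSet I Q φ) :
    fderiv ℝ (fun p : ℝ × E3 => homExt f (∇ (φ p.1) p.2)) p (1, 0) +
      spatialDiv (fun p : ℝ × E3 =>
        ⟪u p.1 p.2, ∇ (φ p.1) p.2⟫ • homExtGrad f (∇ (φ p.1) p.2)) p =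
      volumicDensity f (φ p.1) p.2 * ⟪u p.1 p.2, ∇ (φ p.1) p.2⟫ := by
  obtain ⟨t, x⟩ := p
  have hN := (isOpen_regularSet hI hQ hφ).mem_nhds hp
  have hpI : t ∈ I := hp.1
  have hgd : DifferentiableAt ℝ (fun p : ℝ × E3 => ∇ (φ p.1) p.2) (t, x) :=
    ((contDiffOn_spatialGradient hI hφ).contDiffAt (prod_univ_mem_nhds hI hpI)).differentiableAt
      (by simp)
  have hud : DifferentiableAt ℝ (fun p : ℝ × E3 => u p.1 p.2) (t, x) :=
    (hu.contDiffAt (prod_univ_mem_nhds hI hpI)).differentiableAt (by simp)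
  have hsd : DifferentiableAt ℝ (fun p : ℝ × E3 => ⟪u p.1 p.2, ∇ (φ p.1) p.2⟫) (t, x) :=
    hud.inner ℝ hgd
  have hYd : DifferentiableAt ℝ (fun p : ℝ × E3 => homExtGrad f (∇ (φ p.1) p.2)) (t, x) :=
    ((contDiffOn_comp_spatialGradient hI hφ (contDiffOn_homExtGrad hf)).contDiffAt
      hN).differentiableAt (by simp)
  have h0 : HasFDerivAt (homExt f) (innerSL ℝ (homExtGrad f (∇ (φ t) x))) (∇ (φ t) x) :=
    hasFDerivAt_homExt hf hp.2.2
  have h1 : fderiv ℝ (fun p : ℝ × E3 => homExt f (∇ (φ p.1) p.2)) (t, x) =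
      (innerSL ℝ (homExtGrad f (∇ (φ t) x))).comp
        (fderiv ℝ (fun p : ℝ × E3 => ∇ (φ p.1) p.2) (t, x)) :=
    (HasFDerivAt.comp (g := homExt f) (t, x) h0 hgd.hasFDerivAt).fderiv
  have hs := hasFDerivAt_slice hsd
  have hY := hasFDerivAt_slice hYd
  rw [h1, ← divergence_slice (hsd.fun_smul hYd)]
  have h2 := divergence_smul hs.differentiableAt hY.differentiableAt
  rw [hs.fderiv] at h2
  have h3 := inner_fderiv_spatialGradient_time hI hφ htransport (p := (t, x)) hpI
    (homExtGrad f (∇ (φ t) x))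
  change ⟪homExtGrad f (∇ (φ t) x), fderiv ℝ (fun p : ℝ × E3 => ∇ (φ p.1) p.2) (t, x) (1, 0)⟫ +
    divergence (fun y => ⟪u t y, ∇ (φ t) y⟫ • homExtGrad f (∇ (φ t) y)) x =
    divergence (fun y => homExtGrad f (∇ (φ t) y)) x * ⟪u t x, ∇ (φ t) x⟫
  rw [h2, h3]
  simp only [ContinuousLinearMap.comp_apply, ContinuousLinearMap.inr_apply]
  ring

/-- Over a compact time interval there is a smooth cutoff, supported where `∇φ ≠ 0`, that equals `1`
near the points of `Q` at which `|φ|` is small. -/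
lemma exists_cutoff (hI : IsOpen I) (hQ : IsOpen Q) (hQb : Bornology.IsBounded Q)
    (hφ : ContDiffOn ℝ ∞ (fun p : ℝ × E3 => φ p.1 p.2) (I ×ˢ univ))
    (hregular : ∀ t ∈ I, ∀ x, φ t x = 0 → ∇ (φ t) x ≠ 0)
    (hφQ : ∀ t ∈ I, {x | φ t x = 0} ⊆ Q) {a b : ℝ} (hab : Icc a b ⊆ I) :
    ∃ ε₁ > 0, ∃ χ : ℝ × E3 → ℝ, Admissible (regularSet I Q φ) χ ∧
      ∀ t ∈ Icc a b, ∀ x ∈ Q, |φ t x| ≤ ε₁ →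
        (t, x) ∈ regularSet I Q φ ∧ χ =ᶠ[𝓝 (t, x)] fun _ => 1 := by
  set N := regularSet I Q φ with hNdef
  have hN : IsOpen N := isOpen_regularSet hI hQ hφ
  have hK : IsCompact (Icc a b ×ˢ closure Q) := isCompact_Icc.prod hQb.isCompact_closure
  have hcont : ContinuousOn (fun p : ℝ × E3 => |φ p.1 p.2|) (Icc a b ×ˢ closure Q) :=
    (hφ.continuousOn.mono (prod_mono hab (subset_univ _))).abs
  -- the zero set avoids the boundary of `Q` and the critical points, so `|φ|` has a positive
  -- minimum on the compact remainder
  obtain ⟨ε₁, hε₁, hsub⟩ : ∃ ε₁ > 0, ∀ p ∈ Icc a b ×ˢ closure Q, |φ p.1 p.2| ≤ ε₁ → p ∈ N := by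
    rcases ((Icc a b ×ˢ closure Q) \ N).eq_empty_or_nonempty with hem | hne
    · exact ⟨1, one_pos, fun p hp _ => sdiff_eq_empty.1 hem hp⟩
    · obtain ⟨q, hq, hmin⟩ := (hK.diff hN).exists_isMinOn hne (hcont.mono sdiff_subset)
      have hq0 : 0 < |φ q.1 q.2| := by
        refine abs_pos.2 fun h0 => hq.2 ?_
        have hqI : q.1 ∈ I := hab hq.1.1
        exact ⟨hqI, hφQ q.1 hqI h0, hregular q.1 hqI _ h0⟩
      refine ⟨|φ q.1 q.2| / 2, by positivity, fun p hp hle => ?_⟩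
      by_contra hpN
      have := hmin ⟨hp, hpN⟩
      simp only [mem_ofPred_eq] at this
      linarith
  set K₁ : Set (ℝ × E3) := (Icc a b ×ˢ closure Q) ∩ (fun p : ℝ × E3 => |φ p.1 p.2|) ⁻¹' Iic ε₁
  have hK₁ : IsCompact K₁ :=
    hK.of_isClosed_subset (hcont.preimage_isClosed_of_isClosed hK.isClosed isClosed_Iic)
      inter_subset_left
  obtain ⟨T, hT, hKT, hTN⟩ := exists_compact_between hK₁ hN fun p hp => hsub p hp.1 hp.2
  obtain ⟨χ, hχ1, hχ0, -⟩ := exists_contMDiffMap_one_nhds_of_subset_interior (n := ⊤)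
    (modelWithCornersSelf ℝ (ℝ × E3)) hK₁.isClosed hKT
  have hts : tsupport χ ⊆ T := closure_minimal
    (fun p hp => by_contra fun h => hp (hχ0 p h)) hT.isClosed
  refine ⟨ε₁, hε₁, χ, ⟨contMDiff_iff_contDiff.1 χ.contMDiff,
    hT.of_isClosed_subset isClosed_closure hts, hts.trans hTN⟩, fun t ht x hx hle => ?_⟩
  have hmem : (t, x) ∈ K₁ := ⟨⟨ht, subset_closure hx⟩, hle⟩
  exact ⟨hsub _ hmem.1 hmem.2, hχ1.filter_mono (nhds_le_nhdsSet hmem)⟩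

end SpaceTime

/-! ### The volumic functional as a weighted integral -/

lemma IsCutoff.integral_rescale {ζ : ℝ → ℝ} (hζ : IsCutoff ζ) {ε : ℝ} (hε : 0 < ε) :
    ∫ r, 1 / ε * ζ (r / ε) = 1 := by
  rw [integral_const_mul, Measure.integral_comp_div, hζ.integral_eq_one, abs_of_pos hε]
  simp [hε.ne']

lemma IsCutoff.hasCompactSupport_rescale {ζ : ℝ → ℝ} (hζ : IsCutoff ζ) {ε : ℝ} (hε : 0 < ε) :
    HasCompactSupport fun r => 1 / ε * ζ (r / ε) := by
  refine HasCompactSupport.intro (isCompact_Icc (a := -ε) (b := ε)) fun r hr => ?_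
  rw [hζ.eq_zero, mul_zero]
  rw [abs_div, abs_of_pos hε, lt_div_iff₀ hε, one_mul]
  by_contra h
  exact hr (abs_le.1 (not_lt.1 h))

lemma exists_isCutoff : ∃ ζ, IsCutoff ζ := by
  let b : ContDiffBump (0 : ℝ) := ⟨1 / 2, 1, by norm_num, by norm_num⟩
  refine ⟨b.normed volume, b.contDiff_normed (n := 0) |>.continuous, b.nonneg_normed, ?_,
    b.integral_normed⟩
  rw [b.support_normed_eq, Real.ball_eq_Ioo]
  simpa [b] using Ioo_subset_Icc_self

section

variable {I : Set ℝ} {φ : ℝ → E3 → ℝ} {u : ℝ → E3 → E3} {Q : Set E3} {f : E3 → ℝ}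

/-- Over a compact time interval the volumic functional and its formal derivative are the integrals
of two admissible functions `G₁`, `G₂` against the volumic weight, and `G₂` is the time derivative
of `G₁` up to a quadratic error that is uniform in the cutoff and in `ε`. -/
lemma exists_volumic_representation (hI : IsOpen I)
    (hφ : ContDiffOn ℝ ∞ (fun p : ℝ × E3 => φ p.1 p.2) (I ×ˢ univ))
    (hu : ContDiffOn ℝ ∞ (fun p : ℝ × E3 => u p.1 p.2) (I ×ˢ univ))
    (htransport : ∀ t ∈ I, ∀ x, deriv (fun s => φ s x) t + ⟪u t x, ∇ (φ t) x⟫ = 0)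
    (hregular : ∀ t ∈ I, ∀ x, φ t x = 0 → ∇ (φ t) x ≠ 0)
    (hQ : IsOpen Q) (hQb : Bornology.IsBounded Q) (hφQ : ∀ t ∈ I, {x | φ t x = 0} ⊆ Q)
    (hf : ContDiffOn ℝ ∞ f {0}ᶜ) {a b : ℝ} (hab : Icc a b ⊆ I) :
    ∃ ε₁ > 0, ∃ C, ∃ G₁ G₂ : ℝ × E3 → ℝ,
      Admissible (regularSet I Q φ) G₁ ∧ Admissible (regularSet I Q φ) G₂ ∧
      (∀ t ∈ Icc a b, ∀ x, φ t x = 0 → f (unitNormal (φ t) x) = G₁ (t, x) ∧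
        surfaceDensity f (φ t) x * normalVelocity (u t) (φ t) x = G₂ (t, x)) ∧
      (∀ t ∈ Icc a b, ∀ ζ, IsCutoff ζ → ∀ ε ∈ Ioo 0 ε₁, ∀ x ∈ Q,
        f (unitNormal (φ t) x) * volumicWeight ζ ε (φ t) x =
          G₁ (t, x) * volumicWeight ζ ε (φ t) x ∧
        volumicDensity f (φ t) x * normalVelocity (u t) (φ t) x * volumicWeight ζ ε (φ t) x =
          G₂ (t, x) * volumicWeight ζ ε (φ t) x) ∧
      ∀ ζ, IsCutoff ζ → ∀ ε > 0, ∀ s t,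
        |(∫ x, G₁ (s, x) * volumicWeight ζ ε (φ s) x) -
          (∫ x, G₁ (t, x) * volumicWeight ζ ε (φ t) x) -
          (s - t) * ∫ x, G₂ (t, x) * volumicWeight ζ ε (φ t) x| ≤ C * (s - t) ^ 2 := by
  set N := regularSet I Q φ with hNdef
  have hN : IsOpen N := isOpen_regularSet hI hQ hφ
  have hNI : N ⊆ I ×ˢ univ := fun p hp => ⟨hp.1, mem_univ _⟩
  obtain ⟨ε₁, hε₁, χ, hχ, hχ1⟩ := exists_cutoff hI hQ hQb hφ hregular hφQ hab
  set g : ℝ × E3 → E3 := fun p => ∇ (φ p.1) p.2 with hg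
  have hgN : ContDiffOn ℝ ∞ g N := (contDiffOn_spatialGradient hI hφ).mono hNI
  have huN : ContDiffOn ℝ ∞ (fun p : ℝ × E3 => u p.1 p.2) N := hu.mono hNI
  have hsN : ContDiffOn ℝ ∞ (fun p : ℝ × E3 => ⟪u p.1 p.2, g p⟫) N := huN.inner ℝ hgN
  have hnormN : ContDiffOn ℝ ∞ (fun p => ‖g p‖) N :=
    contDiffOn_comp_spatialGradient hI hφ contDiffOn_norm
  have hinvN : ContDiffOn ℝ ∞ (fun p => ‖g p‖⁻¹) N :=
    hnormN.inv fun p hp => norm_ne_zero_iff.2 hp.2.2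
  have hwN : ContDiffOn ℝ ∞ (fun p => (‖g p‖⁻¹ ^ 2) • g p) N := (hinvN.pow 2).smul hgN
  have hinner : ∀ p ∈ N, ∀ w, fderiv ℝ (fun p : ℝ × E3 => φ p.1 p.2) p (0, w) = ⟪g p, w⟫ :=
    fun p hp w => (inner_gradient_slice hI hφ hp.1 w).symm
  have htime : ∀ p ∈ N, fderiv ℝ (fun p : ℝ × E3 => φ p.1 p.2) p (1, 0) = -⟪u p.1 p.2, g p⟫ :=
    fun p hp => fderiv_time_eq hI hφ htransport hp.1
  have hFN : ContDiffOn ℝ ∞ (fun p => homExt f (g p)) N :=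
    contDiffOn_comp_spatialGradient hI hφ (contDiffOn_homExt hf)
  have hYN : ContDiffOn ℝ ∞ (fun p => homExtGrad f (g p)) N :=
    contDiffOn_comp_spatialGradient hI hφ (contDiffOn_homExtGrad hf)
  have hfN : ContDiffOn ℝ ∞ (fun p => f (‖g p‖⁻¹ • g p)) N :=
    contDiffOn_comp_spatialGradient hI hφ (contDiffOn_comp_normalize hf)
  have ha : Admissible N fun p => χ p • homExt f (g p) := hχ.smul hN hFN
  have hY : Admissible N fun p => χ p • ⟪u p.1 p.2, g p⟫ • homExtGrad f (g p) :=
    hχ.smul hN (hsN.smul hYN)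
  set A : ℝ × E3 → ℝ := fun p => χ p • homExt f (g p) with hA
  set Y : ℝ × E3 → E3 := fun p => χ p • ⟪u p.1 p.2, g p⟫ • homExtGrad f (g p) with hYdef
  set R : ℝ × E3 → ℝ := fun p => fderiv ℝ A p (1, 0) + spatialDiv Y p with hR
  have hRa : Admissible N R := (ha.fderiv_apply (1, 0)).add hY.spatialDiv
  have hG₁ : Admissible N fun p => χ p • f (‖g p‖⁻¹ • g p) := hχ.smul hN hfN
  have hG₂ : Admissible N fun p => R p • ‖g p‖⁻¹ := hRa.smul hN hinvN
  have hR1 : ∀ p ∈ N, χ =ᶠ[𝓝 p] (fun _ => 1) →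
      R p = volumicDensity f (φ p.1) p.2 * ⟪u p.1 p.2, g p⟫ := fun p hp h1 => by
    rw [← volumic_first_variation hI hQ hφ hu htransport hf hp]
    have e1 : A =ᶠ[𝓝 p] fun p => homExt f (∇ (φ p.1) p.2) := by
      filter_upwards [h1] with q hq
      simp [hA, hq, hg]
    have e2 : Y =ᶠ[𝓝 p] fun p =>
        ⟪u p.1 p.2, ∇ (φ p.1) p.2⟫ • homExtGrad f (∇ (φ p.1) p.2) := by
      filter_upwards [h1] with q hq
      simp [hYdef, hq, hg]
    simp only [hR, spatialDiv, e1.fderiv_eq, e2.fderiv_eq]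
  have hG₂1 : ∀ p ∈ N, χ =ᶠ[𝓝 p] (fun _ => 1) → R p • ‖g p‖⁻¹ =
      volumicDensity f (φ p.1) p.2 * normalVelocity (u p.1) (φ p.1) p.2 := fun p hp h1 => by
    rw [hR1 p hp h1, normalVelocity, unitNormal, real_inner_smul_right, smul_eq_mul]
    ring
  have hG₁1 : ∀ p, χ =ᶠ[𝓝 p] (fun _ => 1) →
      χ p • f (‖g p‖⁻¹ • g p) = f (unitNormal (φ p.1) p.2) := fun p h1 => by
    rw [h1.eq_of_nhds, one_smul]; rfl
  obtain ⟨C, -, hC⟩ := exists_weighted_taylor (Φ := fun p : ℝ × E3 => φ p.1 p.2)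
    (w := fun p => (‖g p‖⁻¹ ^ 2) • g p) (u := fun p => u p.1 p.2) (a := A) (Y := Y)
    hN (hφ.mono hNI) hwN (fun p hp => by
      have : ‖g p‖ ≠ 0 := norm_ne_zero_iff.2 hp.2.2
      rw [hinner p hp, real_inner_smul_right, real_inner_self_eq_norm_sq]
      field_simp) huN (fun p hp => by
      rw [htime p hp, hinner p hp, real_inner_comm]; ring) ha hY (fun p hp => by
      rw [htime p hp, hinner p hp]
      simp only [hA, hYdef, real_inner_smul_right, smul_eq_mul]
      have h1 : ⟪g p, homExtGrad f (g p)⟫ = homExt f (g p) := by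
        rw [real_inner_comm]; exact inner_homExtGrad hp.2.2
      rw [h1]
      ring)
  refine ⟨ε₁, hε₁, C, fun p => χ p • f (‖g p‖⁻¹ • g p), fun p => R p • ‖g p‖⁻¹, hG₁, hG₂,
    fun t ht x hx => ?_, fun t ht ζ hζ ε hε x hx => ?_, fun ζ hζ ε hε s t => ?_⟩
  · obtain ⟨hp, h1⟩ := hχ1 t ht x (hφQ t (hab ht) hx) (by rw [hx, abs_zero]; exact hε₁.le)
    refine ⟨(hG₁1 _ h1).symm, ?_⟩
    change _ = R (t, x) • ‖g (t, x)‖⁻¹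
    rw [hG₂1 _ hp h1, volumicDensity_eq_surfaceDensity (contDiff_slice hφ (hab ht)) hf hp.2.2]
  · by_cases hle : |φ t x| ≤ ε₁
    · obtain ⟨hp, h1⟩ := hχ1 t ht x hx hle
      exact ⟨congrArg (· * _) (hG₁1 _ h1).symm, congrArg (· * _) (hG₂1 _ hp h1).symm⟩
    · have h0 : volumicWeight ζ ε (φ t) x = 0 := by
        rw [volumicWeight, hζ.eq_zero, mul_zero, mul_zero]
        rw [abs_div, abs_of_pos hε.1, lt_div_iff₀ hε.1, one_mul]
        linarith [hε.2]
      simp [h0]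
  · have hζc := hζ.continuous
    have h1 : ∀ t x, (χ (t, x) • f (‖g (t, x)‖⁻¹ • g (t, x))) * volumicWeight ζ ε (φ t) x =
        A (t, x) * (1 / ε * ζ (φ t x / ε)) := fun t x => by
      simp only [hA, homExt, volumicWeight, smul_eq_mul, hg]
      ring
    have h2 : ∀ t x, (R (t, x) • ‖g (t, x)‖⁻¹) * volumicWeight ζ ε (φ t) x =
        R (t, x) * (1 / ε * ζ (φ t x / ε)) := fun t x => by
      by_cases hp : (t, x) ∈ N
      · have : ‖g (t, x)‖ ≠ 0 := norm_ne_zero_iff.2 hp.2.2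
        have h3 : volumicWeight ζ ε (φ t) x = ‖g (t, x)‖ * (1 / ε * ζ (φ t x / ε)) := rfl
        rw [h3, smul_eq_mul]
        field_simp
      · rw [image_eq_zero_of_notMem_tsupport fun h => hp (hRa.tsupport_subset h)]
        simp
    simp only [h1, h2]
    refine hC (fun r => 1 / ε * ζ (r / ε)) (by fun_prop) (hζ.hasCompactSupport_rescale hε)
      (fun r => ?_) (hζ.integral_rescale hε) s t
    have := hζ.nonneg (r / ε)
    positivity

lemma tendsto_volumic_slice
    (hφ : ContDiffOn ℝ ∞ (fun p : ℝ × E3 => φ p.1 p.2) (I ×ˢ univ)) {G : ℝ × E3 → ℝ}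
    (hG : Admissible (regularSet I Q φ) G) {t : ℝ} (ht : t ∈ I) :
    IntegrableOn (fun x => G (t, x)) {x | φ t x = 0} μHE[2] ∧ ∀ ζ, IsCutoff ζ →
    Tendsto (fun ε => ∫ x, G (t, x) * volumicWeight ζ ε (φ t) x) (𝓝[>] 0)
      (𝓝 (∫ x in {x | φ t x = 0}, G (t, x) ∂μHE[2])) := by
  refine tendsto_volumic ((contDiff_slice hφ ht).of_le (by simp))
    (hG.contDiff.continuous.comp (by fun_prop)) (hasCompactSupport_slice hG.hasCompactSupport t)
    fun x hx => ?_
  have h1 : (t, x) ∈ tsupport G :=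
    tsupport_comp_subset_preimage G (f := fun x : E3 => (t, x)) (by fun_prop) hx
  exact (hG.tsupport_subset h1).2.2

lemma integrable_volumic_slice
    (hφ : ContDiffOn ℝ ∞ (fun p : ℝ × E3 => φ p.1 p.2) (I ×ˢ univ)) {G : ℝ × E3 → ℝ}
    (hG : Admissible (regularSet I Q φ) G) {ζ : ℝ → ℝ} (hζ : IsCutoff ζ) (ε : ℝ) {t : ℝ}
    (ht : t ∈ I) : Integrable fun x => G (t, x) * volumicWeight ζ ε (φ t) x :=
  ((hG.contDiff.continuous.comp (by fun_prop : Continuous fun x : E3 => (t, x))).mul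
    (continuous_volumicWeight ((contDiff_slice hφ ht).of_le (by simp))
      hζ ε)).integrable_of_hasCompactSupport
    (hasCompactSupport_slice hG.hasCompactSupport t).mul_right

/-- Admissible functions vanish outside `Q`, so restricting the integral to `Q` is harmless. -/
lemma setIntegral_volumic_slice {G : ℝ × E3 → ℝ}
    (hG : Admissible (regularSet I Q φ) G) (hQ : IsOpen Q) {t : ℝ} {w F : E3 → ℝ}
    (hF : ∀ x ∈ Q, F x = G (t, x) * w x) :
    ∫ x in Q, F x = ∫ x, G (t, x) * w x := by
  rw [setIntegral_congr_fun hQ.measurableSet hF]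
  refine setIntegral_eq_integral_of_forall_compl_eq_zero fun x hx => ?_
  rw [image_eq_zero_of_notMem_tsupport fun h => hx (hG.tsupport_subset h).2.1, zero_mul]

lemma exists_Icc_subset_of_isOpen (hI : IsOpen I) {a b : ℝ} (hle : a ≤ b) (hab : Icc a b ⊆ I) :
    ∃ δ > 0, Icc (a - δ) (b + δ) ⊆ I := by
  obtain ⟨δ, hδ, h⟩ := isCompact_Icc.exists_cthickening_subset_open hI hab
  refine ⟨δ, hδ, fun t ht => h ?_⟩
  refine Metric.mem_cthickening_of_dist_le t (max a (min t b)) δ _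
    ⟨le_max_left _ _, max_le hle (min_le_right _ _)⟩ ?_
  obtain ⟨h1, h2⟩ := ht
  rw [Real.dist_eq, abs_le, max_def, min_def]
  split_ifs <;> constructor <;> linarith

end

end LevelSet

theorem mainTheorem3
    -- the open set of times, and the level set function with its velocity field
    (I : Set ℝ) (hI : IsOpen I)
    (φ : ℝ → LevelSet.E3 → ℝ) (u : ℝ → LevelSet.E3 → LevelSet.E3)
    (hφ : ContDiffOn ℝ ∞ (fun p : ℝ × LevelSet.E3 => φ p.1 p.2) (I ×ˢ univ))
    (hu : ContDiffOn ℝ ∞ (fun p : ℝ × LevelSet.E3 => u p.1 p.2) (I ×ˢ univ))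
    (htransport : ∀ t ∈ I, ∀ x, deriv (fun s => φ s x) t + ⟪u t x, ∇ (φ t) x⟫ = 0)
    (hregular : ∀ t ∈ I, ∀ x, φ t x = 0 → ∇ (φ t) x ≠ 0)
    -- the surfaces stay in a bounded open set
    (Q : Set LevelSet.E3) (hQ : IsOpen Q) (hQb : Bornology.IsBounded Q)
    (hφQ : ∀ t ∈ I, {x | φ t x = 0} ⊆ Q)
    (f : LevelSet.E3 → ℝ) (hf : ContDiffOn ℝ ∞ f {0}ᶜ) :
    -- derivative of the surface functional
    (∀ t ∈ I,
      IntegrableOn (fun x => f (LevelSet.unitNormal (φ t) x)) {x | φ t x = 0} μHE[2] ∧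
      IntegrableOn (fun x => LevelSet.surfaceDensity f (φ t) x *
        LevelSet.normalVelocity (u t) (φ t) x) {x | φ t x = 0} μHE[2] ∧
      HasDerivAt (fun s => LevelSet.surfaceFunctional f (φ s))
        (∫ x in {x | φ t x = 0}, LevelSet.surfaceDensity f (φ t) x *
          LevelSet.normalVelocity (u t) (φ t) x ∂μHE[2]) t) ∧
    -- the case of a positively homogeneous function of degree one
    ((∀ s : ℝ, 0 < s → ∀ x : LevelSet.E3, x ≠ 0 → f (s • x) = s * f x) →
      ∀ t ∈ I,
        IntegrableOn (fun x => LevelSet.anisotropicMeanCurvature f (φ t) x *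
          LevelSet.normalVelocity (u t) (φ t) x) {x | φ t x = 0} μHE[2] ∧
        HasDerivAt (fun s => LevelSet.surfaceFunctional f (φ s))
          (∫ x in {x | φ t x = 0}, LevelSet.anisotropicMeanCurvature f (φ t) x *
            LevelSet.normalVelocity (u t) (φ t) x ∂μHE[2]) t) ∧
    -- the two densities agree
    (∀ t ∈ I, ∀ x, ∇ (φ t) x ≠ 0 →
      LevelSet.volumicDensity f (φ t) x = LevelSet.surfaceDensity f (φ t) x) ∧
    -- the volumic approximation: its derivative, and the limits as `ε` tends to `0`
    (∀ ζ : ℝ → ℝ, LevelSet.IsCutoff ζ →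
      (∀ a b : ℝ, Icc a b ⊆ I → ∃ ε₀ > 0, ∀ ε ∈ Ioo 0 ε₀, ∀ t ∈ Icc a b,
        IntegrableOn (fun x => f (LevelSet.unitNormal (φ t) x) *
          LevelSet.volumicWeight ζ ε (φ t) x) Q ∧
        IntegrableOn (fun x => LevelSet.volumicDensity f (φ t) x *
          LevelSet.normalVelocity (u t) (φ t) x * LevelSet.volumicWeight ζ ε (φ t) x) Q ∧
        HasDerivAt (fun s => LevelSet.volumicFunctional Q ζ ε f (φ s))
          (∫ x in Q, LevelSet.volumicDensity f (φ t) x *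
            LevelSet.normalVelocity (u t) (φ t) x * LevelSet.volumicWeight ζ ε (φ t) x) t) ∧
      ∀ t ∈ I,
        Tendsto (fun ε => LevelSet.volumicFunctional Q ζ ε f (φ t)) (𝓝[>] 0)
          (𝓝 (LevelSet.surfaceFunctional f (φ t))) ∧
        Tendsto (fun ε => ∫ x in Q, LevelSet.volumicDensity f (φ t) x *
            LevelSet.normalVelocity (u t) (φ t) x * LevelSet.volumicWeight ζ ε (φ t) x) (𝓝[>] 0)
          (𝓝 (∫ x in {x | φ t x = 0}, LevelSet.surfaceDensity f (φ t) x *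
            LevelSet.normalVelocity (u t) (φ t) x ∂μHE[2]))) := by

  have hJ : ∀ t ∈ I,
      IntegrableOn (fun x => f (LevelSet.unitNormal (φ t) x)) {x | φ t x = 0} μHE[2] ∧
      IntegrableOn (fun x => LevelSet.surfaceDensity f (φ t) x *
        LevelSet.normalVelocity (u t) (φ t) x) {x | φ t x = 0} μHE[2] ∧
      HasDerivAt (fun s => LevelSet.surfaceFunctional f (φ s))
        (∫ x in {x | φ t x = 0}, LevelSet.surfaceDensity f (φ t) x *
          LevelSet.normalVelocity (u t) (φ t) x ∂μHE[2]) t := by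
    intro t ht
    obtain ⟨δ, hδ, hab⟩ := LevelSet.exists_Icc_subset_of_isOpen hI le_rfl
      (by simpa using ht : Icc t t ⊆ I)
    obtain ⟨ε₁, hε₁, C, G₁, G₂, hG₁, hG₂, hS, -, hC⟩ :=
      LevelSet.exists_volumic_representation hI hφ hu htransport hregular hQ hQb hφQ hf hab
    have htm : t ∈ Icc (t - δ) (t + δ) := ⟨by linarith, by linarith⟩
    have hmeas : ∀ s ∈ I, MeasurableSet {x | φ s x = 0} := fun s hs =>
      (isClosed_eq (LevelSet.contDiff_slice hφ hs).continuous continuous_const).measurableSet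
    have hF : ∀ s ∈ Icc (t - δ) (t + δ), LevelSet.surfaceFunctional f (φ s) =
        ∫ x in {x | φ s x = 0}, G₁ (s, x) ∂μHE[2] := fun s hs =>
      setIntegral_congr_fun (hmeas s (hab hs)) fun x hx => (hS s hs x hx).1
    refine ⟨(LevelSet.tendsto_volumic_slice hφ hG₁ ht).1.congr_fun
        (fun x hx => (hS t htm x hx).1.symm) (hmeas t ht),
      (LevelSet.tendsto_volumic_slice hφ hG₂ ht).1.congr_fun
        (fun x hx => (hS t htm x hx).2.symm) (hmeas t ht), ?_⟩
    rw [setIntegral_congr_fun (hmeas t ht) fun x hx => (hS t htm x hx).2]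
    refine LevelSet.hasDerivAt_of_quadratic (C := C) ?_
    filter_upwards [Icc_mem_nhds (by linarith : t - δ < t) (by linarith : t < t + δ)] with s hs
    rw [hF s hs, hF t htm]
    -- let `ε → 0` in the Taylor estimate for the volumic functionals
    obtain ⟨ζ, hζ⟩ := LevelSet.exists_isCutoff
    have hlim := ((((LevelSet.tendsto_volumic_slice hφ hG₁ (hab hs)).2 ζ hζ).sub
      ((LevelSet.tendsto_volumic_slice hφ hG₁ ht).2 ζ hζ)).sub
      (((LevelSet.tendsto_volumic_slice hφ hG₂ ht).2 ζ hζ).const_mul (s - t))).abs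
    refine le_of_tendsto hlim ?_
    filter_upwards [self_mem_nhdsWithin] with ε hε using hC ζ hζ ε hε s t
  refine ⟨hJ, fun hhom t ht => ?_, fun t ht x hx =>
    LevelSet.volumicDensity_eq_surfaceDensity (LevelSet.contDiff_slice hφ ht) hf hx,
    fun ζ hζ => ⟨fun a b hab => ?_, fun t ht => ?_⟩⟩
  · have hmeas : MeasurableSet {x | φ t x = 0} :=
      (isClosed_eq (LevelSet.contDiff_slice hφ ht).continuous continuous_const).measurableSet
    have heq : EqOn (fun x => LevelSet.surfaceDensity f (φ t) x *
          LevelSet.normalVelocity (u t) (φ t) x)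
        (fun x => LevelSet.anisotropicMeanCurvature f (φ t) x *
          LevelSet.normalVelocity (u t) (φ t) x) {x | φ t x = 0} := fun x hx => by
      simp only [LevelSet.anisotropicMeanCurvature_eq_surfaceDensity
        (LevelSet.contDiff_slice hφ ht) hf hhom (hregular t ht x hx)]
    obtain ⟨-, h2, h3⟩ := hJ t ht
    rw [setIntegral_congr_fun hmeas heq] at h3
    exact ⟨h2.congr_fun heq hmeas, h3⟩
  · rcases lt_or_ge b a with hlt | hle
    · exact ⟨1, one_pos, fun ε _ t ht => absurd (ht.1.trans ht.2) (not_le.2 hlt)⟩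
    obtain ⟨δ, hδ, hab'⟩ := LevelSet.exists_Icc_subset_of_isOpen hI hle hab
    obtain ⟨ε₁, hε₁, C, G₁, G₂, hG₁, hG₂, -, hV, hC⟩ :=
      LevelSet.exists_volumic_representation hI hφ hu htransport hregular hQ hQb hφQ hf hab'
    refine ⟨ε₁, hε₁, fun ε hε t ht => ?_⟩
    have hsub : ∀ s ∈ Icc (a - δ) (b + δ), LevelSet.volumicFunctional Q ζ ε f (φ s) =
        ∫ x, G₁ (s, x) * LevelSet.volumicWeight ζ ε (φ s) x := fun s hs =>
      LevelSet.setIntegral_volumic_slice hG₁ hQ fun x hx => (hV s hs ζ hζ ε hε x hx).1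
    have htm : t ∈ Icc (a - δ) (b + δ) := ⟨by linarith [ht.1], by linarith [ht.2]⟩
    refine ⟨(LevelSet.integrable_volumic_slice hφ hG₁ hζ ε (hab ht)).integrableOn.congr_fun
        (fun x hx => (hV t htm ζ hζ ε hε x hx).1.symm) hQ.measurableSet,
      (LevelSet.integrable_volumic_slice hφ hG₂ hζ ε (hab ht)).integrableOn.congr_fun
        (fun x hx => (hV t htm ζ hζ ε hε x hx).2.symm) hQ.measurableSet, ?_⟩
    rw [LevelSet.setIntegral_volumic_slice hG₂ hQ fun x hx => (hV t htm ζ hζ ε hε x hx).2]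
    refine LevelSet.hasDerivAt_of_quadratic (C := C) ?_
    filter_upwards [Icc_mem_nhds (by linarith [ht.1] : a - δ < t)
      (by linarith [ht.2] : t < b + δ)] with s hs
    rw [hsub s hs, hsub t htm]
    exact hC ζ hζ ε hε.1 s t
  · obtain ⟨ε₁, hε₁, -, G₁, G₂, hG₁, hG₂, hS, hV, -⟩ :=
      LevelSet.exists_volumic_representation hI hφ hu htransport hregular hQ hQb hφQ hf
        (by simpa using ht : Icc t t ⊆ I)
    have htm : t ∈ Icc t t := ⟨le_rfl, le_rfl⟩
    have hmeas : MeasurableSet {x | φ t x = 0} :=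
      (isClosed_eq (LevelSet.contDiff_slice hφ ht).continuous continuous_const).measurableSet
    rw [LevelSet.surfaceFunctional,
      setIntegral_congr_fun hmeas fun x hx => (hS t htm x hx).1,
      setIntegral_congr_fun hmeas fun x hx => (hS t htm x hx).2]
    refine ⟨((LevelSet.tendsto_volumic_slice hφ hG₁ ht).2 ζ hζ).congr' ?_,
      ((LevelSet.tendsto_volumic_slice hφ hG₂ ht).2 ζ hζ).congr' ?_⟩ <;>
    filter_upwards [Ioo_mem_nhdsGT hε₁] with ε hε
    · exact (LevelSet.setIntegral_volumic_slice hG₁ hQ fun x hx =>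
        (hV t htm ζ hζ ε hε x hx).1).symm
    · exact (LevelSet.setIntegral_volumic_slice hG₂ hQ fun x hx =>
        (hV t htm ζ hζ ε hε x hx).2).symm
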